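/- Let $n\ge 1$, let $\lambda\vdash n$, and let $S^\lambda$ be the real Specht module of the symmetric group $S_n$: the span of the polytabloids $v_T=\sum_{\sigma\in C(T)}\mathrm{sgn}(\sigma)\,\sigma\{T\}$ ($T$ a Young tableau of shape $\lambda$, with column stabilizer $C(T)$ and tabloid $\{T\}$) inside the real vector space with basis the tabloids of shape $\lambda$. Let $S=\{(i,i+1)\mid 1\le i\le n-1\}$ be the set of simple reflections. By a proper invariant cone we mean a closed subset $C\subseteq S^\lambda$ that is closed under non-negative linear combinations, satisfies $(1+s)C\subseteq C$ for all $s\in S$, is pointed ($C\cap(-C)=\{0\}$) and is solid (has non-empty interior). If $C$ is a proper invariant cone, then so is $-C$. Then there are proper invariant cones $C^{\max}$ and $C^{\min}$ in $S^\lambda$ such that: 1. $C^{\max}$ is, up to sign, the unique maximal proper invariant cone: the maximal elements, with respect to inclusion, of the set of proper invariant cones are exactly $C^{\max}$ and $-C^{\max}$. 2. $C^{\min}$ is, up to sign, the unique minimal proper invariant cone: the minimal elements, with respect to inclusion, of the set of proper invariant cones are exactly $C^{\min}$ and $-C^{\min}$. 3. Every proper invariant cone $C$ satisfies $C^{\min}\subseteq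 C\subseteq C^{\max}$ or $C^{\min}\subseteq -C\subseteq C^{\max}$. 4. For every positive definite symmetric $S_n$-invariant bilinear form $(\cdot,\cdot)$ on $S^\lambda$ one has $(C^{\max})^*=C^{\min}$, where $C^*=\{u\in S^\lambda\mid (u,c)\ge 0 \text{ for all } c\in C\}$ denotes the dual cone with respect to the form. -/

import Mathlib

open scoped Pointwise

noncomputable section

namespace InvariantCones

open Equiv

/-- A Young tableau of shape `lam` with entries `0, …, n - 1`: a bijective filling of the boxes.
A box is a pair `(row, column)`. (There is none unless `lam` has exactly `n` boxes.) -/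
def Tableau (lam : YoungDiagram) (n : ℕ) : Type := {c // c ∈ lam.cells} ≃ Fin n

namespace Tableau

variable {lam : YoungDiagram} {n : ℕ}

/-- The row containing the entry `k`. -/
def row (T : Tableau lam n) (k : Fin n) : ℕ := (T.symm k).1.1

/-- The column containing the entry `k`. -/
def col (T : Tableau lam n) (k : Fin n) : ℕ := (T.symm k).1.2

/-- The symmetric group acts on tableaux by applying a permutation to every entry. -/
instance : MulAction (Perm (Fin n)) (Tableau lam n) where
  smul σ T := Equiv.trans T σ
  one_smul _ := rfl
  mul_smul _ _ _ := rfl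

theorem row_smul (σ : Perm (Fin n)) (T : Tableau lam n) (k : Fin n) :
    (σ • T).row k = T.row (σ⁻¹ k) := rfl

theorem col_smul (σ : Perm (Fin n)) (T : Tableau lam n) (k : Fin n) :
    (σ • T).col k = T.col (σ⁻¹ k) := rfl

/-- The row stabilizer `R(T)`. -/
def rowStabilizer (T : Tableau lam n) : Subgroup (Perm (Fin n)) where
  carrier := {σ | ∀ k, T.row (σ k) = T.row k}
  one_mem' _ := rfl
  mul_mem' {a b} ha hb k := (ha (b k)).trans (hb k)
  inv_mem' {a} ha k := by simpa using (ha (a⁻¹ k)).symm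

/-- The column stabilizer `C(T)`. -/
def colStabilizer (T : Tableau lam n) : Subgroup (Perm (Fin n)) where
  carrier := {σ | ∀ k, T.col (σ k) = T.col k}
  one_mem' _ := rfl
  mul_mem' {a b} ha hb k := (ha (b k)).trans (hb k)
  inv_mem' {a} ha k := by simpa using (ha (a⁻¹ k)).symm

theorem mem_rowStabilizer {T : Tableau lam n} {σ : Perm (Fin n)} :
    σ ∈ T.rowStabilizer ↔ ∀ k, T.row (σ k) = T.row k := Iff.rfl

theorem mem_colStabilizer {T : Tableau lam n} {σ : Perm (Fin n)} :
    σ ∈ T.colStabilizer ↔ ∀ k, T.col (σ k) = T.col k := Iff.rfl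

theorem mem_rowStabilizer_smul {T : Tableau lam n} {σ τ : Perm (Fin n)} :
    τ ∈ (σ • T).rowStabilizer ↔ σ⁻¹ * τ * σ ∈ T.rowStabilizer := by
  simp only [mem_rowStabilizer, row_smul, Perm.mul_apply]
  exact ⟨fun h k => by simpa using h (σ k), fun h k => by simpa using h (σ⁻¹ k)⟩

theorem mem_colStabilizer_smul {T : Tableau lam n} {σ τ : Perm (Fin n)} :
    τ ∈ (σ • T).colStabilizer ↔ σ⁻¹ * τ * σ ∈ T.colStabilizer := by
  simp only [mem_colStabilizer, col_smul, Perm.mul_apply]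
  exact ⟨fun h k => by simpa using h (σ k), fun h k => by simpa using h (σ⁻¹ k)⟩

/-- Two tableaux are row equivalent if they differ by an element of the row stabilizer. -/
def rowSetoid (lam : YoungDiagram) (n : ℕ) : Setoid (Tableau lam n) where
  r T T' := ∃ σ ∈ T.rowStabilizer, T' = σ • T
  iseqv :=
    { refl := fun T => ⟨1, one_mem _, (one_smul _ T).symm⟩
      symm := by
        rintro T _ ⟨σ, hσ, rfl⟩
        refine ⟨σ⁻¹, ?_, (inv_smul_smul σ T).symm⟩
        rw [mem_rowStabilizer_smul]
        simpa using inv_mem hσ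
      trans := by
        rintro T _ _ ⟨σ, hσ, rfl⟩ ⟨τ, hτ, rfl⟩
        refine ⟨τ * σ, ?_, (mul_smul τ σ T).symm⟩
        rw [mem_rowStabilizer_smul] at hτ
        have := mul_mem hσ hτ
        simpa [mul_assoc] using this }

end Tableau

/-- A tabloid: a row equivalence class of tableaux. -/
def Tabloid (lam : YoungDiagram) (n : ℕ) : Type := Quotient (Tableau.rowSetoid lam n)

variable {lam : YoungDiagram} {n : ℕ}

/-- The tabloid `{T}` of a tableau `T`. -/
def Tableau.tabloid (T : Tableau lam n) : Tabloid lam n := Quotient.mk _ T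

/-- The symmetric group acts on tabloids by `σ {T} = {σ T}`. -/
instance : MulAction (Perm (Fin n)) (Tabloid lam n) where
  smul σ := Quotient.map (fun T => σ • T) (by
    rintro T _ ⟨τ, hτ, rfl⟩
    refine ⟨σ * τ * σ⁻¹, ?_, by simp [mul_smul]⟩
    rw [Tableau.mem_rowStabilizer_smul]
    simpa [mul_assoc] using hτ)
  one_smul t := Quotient.inductionOn t fun T => congrArg _ (one_smul _ T)
  mul_smul σ τ t := Quotient.inductionOn t fun T => congrArg _ (mul_smul σ τ T)

theorem Tableau.smul_tabloid (σ : Perm (Fin n)) (T : Tableau lam n) :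
    σ • T.tabloid = (σ • T).tabloid := rfl

/-- The real permutation module `M^lam` on tabloids, realised as real functions on the finite set
of tabloids; the tabloid `t` is the function `Pi.single t 1`. -/
abbrev TabloidModule (lam : YoungDiagram) (n : ℕ) : Type := Tabloid lam n → ℝ

/-- The action of the symmetric group on `M^lam`. -/
def tabloidRep (lam : YoungDiagram) (n : ℕ) :
    Representation ℝ (Perm (Fin n)) (TabloidModule lam n) where
  toFun σ := LinearMap.funLeft ℝ ℝ fun t => σ⁻¹ • t
  map_one' := by ext f t; simp [LinearMap.funLeft_apply]
  map_mul' σ τ := by ext f t; simp [LinearMap.funLeft_apply, mul_smul]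

open Classical in
/-- The element `{T}` of `M^lam`. -/
def tabloidVec (t : Tabloid lam n) : TabloidModule lam n := Pi.single t 1

theorem tabloidRep_tabloidVec (σ : Perm (Fin n)) (t : Tabloid lam n) :
    tabloidRep lam n σ (tabloidVec t) = tabloidVec (σ • t) := by
  classical
  ext u
  simp [tabloidRep, tabloidVec, LinearMap.funLeft_apply, Pi.single_apply, inv_smul_eq_iff]

open Classical in
/-- The polytabloid `v_T = ∑_{σ ∈ C(T)} sgn(σ) σ{T}`. -/
def polytabloid (T : Tableau lam n) : TabloidModule lam n :=
  ∑ σ : T.colStabilizer,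
    ((Perm.sign (σ : Perm (Fin n)) : ℤ) : ℝ) • tabloidRep lam n σ (tabloidVec T.tabloid)

theorem tabloidRep_polytabloid (σ : Perm (Fin n)) (T : Tableau lam n) :
    tabloidRep lam n σ (polytabloid T) = polytabloid (σ • T) := by
  classical
  unfold polytabloid
  rw [map_sum]
  refine Fintype.sum_bijective
    (fun τ : T.colStabilizer => (⟨σ * τ * σ⁻¹, by
      rw [Tableau.mem_colStabilizer_smul]; simp [mul_assoc]⟩ : (σ • T).colStabilizer))
    ⟨fun a b h => ?_, fun b => ⟨⟨σ⁻¹ * b * σ, Tableau.mem_colStabilizer_smul.1 b.2⟩, ?_⟩⟩ _ _ ?_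
  · exact Subtype.ext (mul_left_cancel (mul_right_cancel (congrArg Subtype.val h)))
  · simp [mul_assoc]
  · intro τ
    have h : Perm.sign (σ * τ * σ⁻¹ : Perm (Fin n)) = Perm.sign (τ : Perm (Fin n)) := by
      rw [Perm.sign_mul, Perm.sign_mul, Perm.sign_inv, mul_right_comm, Int.units_mul_self, one_mul]
    simp only [map_smul, h, tabloidRep_tabloidVec, Tableau.smul_tabloid, smul_smul]
    simp [mul_assoc]

/-- The real Specht module `S^lam`: the span of the polytabloids in `M^lam`. It carries the subspace
topology, which is the Euclidean topology of this finite-dimensional space. -/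
def specht (lam : YoungDiagram) (n : ℕ) : Submodule ℝ (TabloidModule lam n) :=
  Submodule.span ℝ (Set.range polytabloid)

theorem tabloidRep_mem_specht (σ : Perm (Fin n)) :
    ∀ x ∈ specht lam n, tabloidRep lam n σ x ∈ specht lam n := by
  intro x hx
  have : specht lam n ≤ (specht lam n).comap (tabloidRep lam n σ) := by
    refine Submodule.span_le.2 ?_
    rintro _ ⟨T, rfl⟩
    simp only [Submodule.comap_coe, Set.mem_preimage, SetLike.mem_coe, tabloidRep_polytabloid]
    exact Submodule.subset_span ⟨_, rfl⟩
  exact this hx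

/-- The action of the symmetric group on the Specht module. -/
def spechtRep (lam : YoungDiagram) (n : ℕ) :
    Representation ℝ (Perm (Fin n)) (specht lam n) where
  toFun σ := (tabloidRep lam n σ).restrict (tabloidRep_mem_specht σ)
  map_one' := by ext x; simp
  map_mul' σ τ := by ext x; simp

/-- The simple reflections of the symmetric group: the adjacent transpositions. -/
def simpleReflections (n : ℕ) : Set (Perm (Fin n)) :=
  {s | ∃ i j : Fin n, (i : ℕ) + 1 = j ∧ s = swap i j}

/-- The family of operators `1 + s` on the Specht module, `s` a simple reflection. -/
def onePlusReflections (lam : YoungDiagram) (n : ℕ) : Set (Module.End ℝ (specht lam n)) :=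
  {A | ∃ s ∈ simpleReflections n, A = 1 + spechtRep lam n s}

/-- A closed convex cone `C` (a `PointedCone` of Mathlib is a set closed under non-negative linear
combinations) that is mapped into itself by the operators in `𝒜`, that contains no line and that
has non-empty interior. -/
structure IsProperInvariantCone {V : Type*} [AddCommGroup V] [Module ℝ V] [TopologicalSpace V]
    (𝒜 : Set (Module.End ℝ V)) (C : PointedCone ℝ V) : Prop where
  isClosed : IsClosed (C : Set V)
  invariant : ∀ A ∈ 𝒜, ∀ x ∈ C, A x ∈ C
  pointed : C ⊓ -C = ⊥
  solid : (interior (C : Set V)).Nonempty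

/-- A positive definite symmetric bilinear form that is invariant under a representation. -/
structure IsInvariantInnerForm {G V : Type*} [Group G] [AddCommGroup V] [Module ℝ V]
    (ρ : Representation ℝ G V) (B : LinearMap.BilinForm ℝ V) : Prop where
  symm : ∀ x y, B x y = B y x
  posDef : ∀ x, x ≠ 0 → 0 < B x x
  invariant : ∀ g x y, B (ρ g x) (ρ g y) = B x y

/-- The dual cone `{u | (u, c) ≥ 0 for all c ∈ C}` of `C` with respect to a bilinear form. -/
def dualCone {V : Type*} [AddCommGroup V] [Module ℝ V] (B : LinearMap.BilinForm ℝ V)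
    (C : PointedCone ℝ V) : PointedCone ℝ V :=
  PointedCone.dual B.flip (C : Set V)

theorem mem_dualCone {V : Type*} [AddCommGroup V] [Module ℝ V] {B : LinearMap.BilinForm ℝ V}
    {C : PointedCone ℝ V} {u : V} : u ∈ dualCone B C ↔ ∀ c ∈ C, 0 ≤ B u c :=
  ⟨fun h _ hc => h hc, fun h c hc => h c hc⟩

end InvariantCones

end

/-! Choose a tableau `T` whose rows hold increasing blocks of entries, so that its row stabilizer
R(T) is a standard parabolic subgroup, and let P be the sum of the elements of R(T). By column
sorting, P maps the Specht module to the line of the nonzero vector u = P v_T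
(`symmetrizer_mem_span`), so for every invariant form B the vector P x is a positive multiple of
B(u, x) u. A closed cone stable under all 1 + s is also stable under P (`sum_stabilizer_mem`): among
the points of the cone in the convex hull of the R(T)-orbit of x, the shortest one is fixed by R(T),
since averaging with a reflection would shorten it, and it is therefore the mean of the orbit. Hence
a proper invariant cone contains u or -u, and pointedness fixes the sign of B(u, ·) on it.

Take for C^min the least closed invariant cone containing u, and for C^max its dual. If u lies in a
proper invariant cone C, then C^min ⊆ C; moreover u lies in the dual of C, so C^min ⊆ C^*, which
means C ⊆ C^max. The bipolar theorem gives the duality. C^min is solid because u generates the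
module, and it is pointed as soon as some proper invariant cone exists.

Existence comes from Young's seminormal form. By Garnir relations, the polytabloid of the column
reading tableau is a joint eigenvector of the Jucys–Murphy elements, with the contents as
eigenvalues (`sum_lt_swap_polytabloid`). Intertwiners carry it to orthogonal vectors that span the
module, and 1 + s has non-negative coefficients on them because differences of contents are integers
(`exists_onePlus_seminormal`). The dual of the cone that they span is proper
(`exists_isProperInvariantCone`). -/

set_option linter.unusedSectionVars false

open scoped Pointwise

noncomputable section

namespace InvariantCones

open Equiv

/-! ### Cones: the abstract classification from a rank one operator. -/

section Cones

variable {V : Type*} [AddCommGroup V] [Module ℝ V]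

/-- A positive definite symmetric bilinear form for which all operators in `𝒜` are self-adjoint. -/
structure IsSelfAdjointForm (𝒜 : Set (Module.End ℝ V)) (B : LinearMap.BilinForm ℝ V) : Prop where
  symm : ∀ x y, B x y = B y x
  posDef : ∀ x, x ≠ 0 → 0 < B x x
  selfAdjoint : ∀ A ∈ 𝒜, ∀ x y, B (A x) y = B x (A y)

variable {𝒜 : Set (Module.End ℝ V)}

theorem dualCone_invariant {B : LinearMap.BilinForm ℝ V} (hB : IsSelfAdjointForm 𝒜 B)
    {C : PointedCone ℝ V} (hC : ∀ A ∈ 𝒜, ∀ x ∈ C, A x ∈ C) :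
    ∀ A ∈ 𝒜, ∀ x ∈ dualCone B C, A x ∈ dualCone B C := fun A hA x hx =>
  mem_dualCone.2 fun c hc => by
    rw [hB.selfAdjoint A hA]
    exact mem_dualCone.1 hx _ (hC A hA c hc)

variable [TopologicalSpace V]

/-- The least closed cone that contains `u` and is mapped into itself by the operators in `𝒜`. -/
def leastCone (𝒜 : Set (Module.End ℝ V)) (u : V) : PointedCone ℝ V :=
  sInf {C | IsClosed (C : Set V) ∧ (∀ A ∈ 𝒜, ∀ x ∈ C, A x ∈ C) ∧ u ∈ C}

theorem leastCone_le {u : V} {C : PointedCone ℝ V} (hC : IsClosed (C : Set V))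
    (hA : ∀ A ∈ 𝒜, ∀ x ∈ C, A x ∈ C) (hu : u ∈ C) : leastCone 𝒜 u ≤ C :=
  sInf_le ⟨hC, hA, hu⟩

theorem mem_leastCone_self (𝒜 : Set (Module.End ℝ V)) (u : V) : u ∈ leastCone 𝒜 u :=
  Submodule.mem_sInf.2 fun _ h => h.2.2

theorem isClosed_leastCone (𝒜 : Set (Module.End ℝ V)) (u : V) :
    IsClosed (leastCone 𝒜 u : Set V) := by
  rw [leastCone, Submodule.coe_sInf]
  exact isClosed_biInter fun C hC => hC.1

theorem leastCone_invariant (u : V) : ∀ A ∈ 𝒜, ∀ x ∈ leastCone 𝒜 u, A x ∈ leastCone 𝒜 u :=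
  fun A hA _ hx => Submodule.mem_sInf.2 fun _ h => h.2.1 A hA _ (Submodule.mem_sInf.1 hx _ h)

theorem IsProperInvariantCone.not_mem_neg {C : PointedCone ℝ V} (h : IsProperInvariantCone 𝒜 C)
    {x : V} (hx : x ≠ 0) (hxC : x ∈ C) : -x ∉ C := fun hn => hx <| by
  have : x ∈ C ⊓ -C := ⟨hxC, Submodule.mem_neg.2 hn⟩
  rwa [h.pointed, Submodule.mem_bot] at this

variable [IsTopologicalAddGroup V]

theorem IsProperInvariantCone.neg {C : PointedCone ℝ V} (h : IsProperInvariantCone 𝒜 C) :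
    IsProperInvariantCone 𝒜 (-C) where
  isClosed := by
    rw [Submodule.coe_set_neg]
    exact h.isClosed.neg
  invariant A hA x hx := by
    rw [Submodule.mem_neg] at hx ⊢
    simpa using h.invariant A hA _ hx
  pointed := by rw [neg_neg, inf_comm, h.pointed]
  solid := by
    rw [Submodule.coe_set_neg]
    obtain ⟨x, hx⟩ := h.solid
    refine ⟨-x, ?_⟩
    have := (Homeomorph.neg V).preimage_interior (C : Set V)
    have h2 : -x ∈ (Homeomorph.neg V) ⁻¹' interior (C : Set V) := by simpa using hx
    rw [this] at h2
    exact h2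

theorem maximal_neg {C : PointedCone ℝ V}
    (h : Maximal (IsProperInvariantCone 𝒜) C) : Maximal (IsProperInvariantCone 𝒜) (-C) :=
  ⟨h.1.neg, fun D hD hle => by
    rw [← Submodule.neg_le]
    exact h.2 hD.neg (by rwa [← Submodule.neg_le])⟩

theorem minimal_neg {C : PointedCone ℝ V}
    (h : Minimal (IsProperInvariantCone 𝒜) C) : Minimal (IsProperInvariantCone 𝒜) (-C) :=
  ⟨h.1.neg, fun D hD hle => by
    rw [Submodule.neg_le]
    exact h.2 hD.neg (by rwa [Submodule.neg_le])⟩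

variable [ContinuousSMul ℝ V] [T2Space V] [FiniteDimensional ℝ V]

theorem isClosed_dualCone (B : LinearMap.BilinForm ℝ V) (C : PointedCone ℝ V) :
    IsClosed (dualCone B C : Set V) :=
  PointedCone.isClosed_dual fun x => LinearMap.continuous_of_finiteDimensional (B.flip x)

/-- A cone that spans the space has non-empty interior. -/
theorem interior_nonempty_of_span_eq_top {C : PointedCone ℝ V}
    (hC : Submodule.span ℝ (C : Set V) = ⊤) : (interior (C : Set V)).Nonempty := by
  obtain ⟨b, hb⟩ : ∃ b : Module.Basis (Fin (Module.finrank ℝ V)) ℝ V, ∀ i, b i ∈ C := by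
    obtain ⟨s, hs, hsp, hli⟩ := exists_linearIndependent ℝ (C : Set V)
    rw [hC] at hsp
    let b₀ : Module.Basis s ℝ V := Module.Basis.mk hli (by simp [hsp])
    have : Fintype s := FiniteDimensional.fintypeBasisIndex b₀
    have hcard : Fintype.card s = Module.finrank ℝ V := (Module.finrank_eq_card_basis b₀).symm
    refine ⟨b₀.reindex (Fintype.equivFinOfCardEq hcard), fun i => ?_⟩
    simp only [Module.Basis.reindex_apply, b₀, Module.Basis.mk_apply]
    exact hs (Subtype.coe_prop _)
  -- The open positive orthant of a basis chosen inside `C` lies in `C`.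
  have hopen : IsOpen {x : V | ∀ i, 0 < b.coord i x} := by
    simp only [Set.ofPred_forall]
    exact isOpen_iInter_of_finite fun i =>
      isOpen_lt continuous_const (LinearMap.continuous_of_finiteDimensional _)
  refine ⟨∑ i, b i, interior_maximal ?_ hopen ?_⟩
  · intro x hx
    rw [SetLike.mem_coe, ← b.sum_repr x]
    exact Submodule.sum_mem _ fun i _ => C.smul_mem (hx i).le (hb i)
  · intro i
    simp [Module.Basis.coord_apply, Finsupp.single_apply]

/-- Membership in a convex cone persists after a small displacement from an interior point. -/
theorem exists_pos_add_smul_mem {C : Set V} {x : V} (hx : x ∈ interior C) (u : V) :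
    ∃ ε : ℝ, 0 < ε ∧ x + ε • u ∈ C := by
  have hc : Filter.Tendsto (fun ε : ℝ => x + ε • u) (nhdsWithin 0 (Set.Ioi 0)) (nhds x) := by
    have : Continuous fun ε : ℝ => x + ε • u := by fun_prop
    simpa using (this.tendsto 0).mono_left nhdsWithin_le_nhds
  have h1 := hc.eventually (mem_interior_iff_mem_nhds.1 hx)
  obtain ⟨ε, h2, h3⟩ := (h1.and self_mem_nhdsWithin).exists
  exact ⟨ε, h3, h2⟩

/-- Everything that the classification of proper invariant cones needs to know about `𝒜`: there is
a vector `u` such that the closed invariant cones are preserved by the rank one operators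
`x ↦ B u x • u`, which generates the space, and there is a proper invariant cone. -/
structure IsConeGenerator (𝒜 : Set (Module.End ℝ V)) (u : V) : Prop where
  ne_zero : u ≠ 0
  smul_mem : ∀ (B : LinearMap.BilinForm ℝ V), IsSelfAdjointForm 𝒜 B → ∀ C : PointedCone ℝ V,
    IsClosed (C : Set V) → (∀ A ∈ 𝒜, ∀ x ∈ C, A x ∈ C) → ∀ x ∈ C, B u x • u ∈ C
  cyclic : ∀ U : Submodule ℝ V, (∀ A ∈ 𝒜, ∀ x ∈ U, A x ∈ U) → u ∈ U → U = ⊤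
  exists_proper : ∃ C, IsProperInvariantCone 𝒜 C

namespace IsConeGenerator

variable {u : V}

theorem span_leastCone (hu : IsConeGenerator 𝒜 u) :
    Submodule.span ℝ (leastCone 𝒜 u : Set V) = ⊤ := by
  refine hu.cyclic _ (fun A hA x hx => ?_) (Submodule.subset_span (mem_leastCone_self 𝒜 u))
  have : Submodule.span ℝ (leastCone 𝒜 u : Set V) ≤
      (Submodule.span ℝ (leastCone 𝒜 u : Set V)).comap A :=
    Submodule.span_le.2 fun y hy => Submodule.subset_span (leastCone_invariant u A hA y hy)
  exact this hx

variable {B : LinearMap.BilinForm ℝ V}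

/-- A solid cone is not contained in the hyperplane orthogonal to `u`; the rank one operator sends a
point off this hyperplane to a nonzero multiple of `u`. -/
theorem mem_or_neg_mem (hu : IsConeGenerator 𝒜 u) (hB : IsSelfAdjointForm 𝒜 B)
    {C : PointedCone ℝ V} (hC : IsProperInvariantCone 𝒜 C) :
    u ∈ C ∨ -u ∈ C := by
  obtain ⟨x, hx, hne⟩ : ∃ x ∈ C, B u x ≠ 0 := by
    obtain ⟨x, hx⟩ := hC.solid
    by_cases h : B u x = 0
    · obtain ⟨ε, hε, hm⟩ := exists_pos_add_smul_mem hx u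
      refine ⟨_, hm, ?_⟩
      simp [h, hε.ne', (hB.posDef u hu.ne_zero).ne']
    · exact ⟨x, interior_subset hx, h⟩
  have h := hu.smul_mem B hB C hC.isClosed hC.invariant x hx
  rcases lt_or_gt_of_ne hne with hlt | hgt
  · right
    have := C.smul_mem (r := (-B u x)⁻¹) (inv_nonneg.2 (by linarith)) h
    rwa [smul_smul, inv_neg, neg_mul, inv_mul_cancel₀ hne, neg_smul, one_smul] at this
  · left
    have := C.smul_mem (r := (B u x)⁻¹) (inv_nonneg.2 hgt.le) h
    rwa [smul_smul, inv_mul_cancel₀ hne, one_smul] at this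

/-- A point with `B u x < 0` would put `-u` into `C`, against pointedness. So `u` lies in the closed
invariant cone `dualCone B C`, which then contains `leastCone 𝒜 u`; symmetry of `B` reverses the
roles. -/
theorem le_dualCone_leastCone (hu : IsConeGenerator 𝒜 u) (hB : IsSelfAdjointForm 𝒜 B)
    {C : PointedCone ℝ V} (hC : IsProperInvariantCone 𝒜 C)
    (huC : u ∈ C) : C ≤ dualCone B (leastCone 𝒜 u) := by
  have hle : leastCone 𝒜 u ≤ dualCone B C := by
    refine leastCone_le (isClosed_dualCone B C) (dualCone_invariant hB hC.invariant) ?_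
    refine mem_dualCone.2 fun x hx => ?_
    by_contra! hlt
    have h := C.smul_mem (r := (-B u x)⁻¹) (inv_nonneg.2 (by linarith))
      (hu.smul_mem B hB C hC.isClosed hC.invariant x hx)
    rw [smul_smul, inv_neg, neg_mul, inv_mul_cancel₀ hlt.ne, neg_smul, one_smul] at h
    exact hC.not_mem_neg hu.ne_zero huC h
  intro x hx
  refine mem_dualCone.2 fun y hy => ?_
  rw [hB.symm]
  exact mem_dualCone.1 (hle hy) x hx

theorem exists_proper_mem (hu : IsConeGenerator 𝒜 u) (hB : IsSelfAdjointForm 𝒜 B) :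
    ∃ C, IsProperInvariantCone 𝒜 C ∧ u ∈ C := by
  obtain ⟨C, hC⟩ := hu.exists_proper
  rcases hu.mem_or_neg_mem hB hC with h | h
  · exact ⟨C, hC, h⟩
  · exact ⟨-C, hC.neg, Submodule.mem_neg.2 h⟩

/-- Pointedness is inherited from any proper invariant cone around `u`; this is the only use of
`exists_proper`. -/
theorem isProperInvariantCone_leastCone (hu : IsConeGenerator 𝒜 u) (hB : IsSelfAdjointForm 𝒜 B) :
    IsProperInvariantCone 𝒜 (leastCone 𝒜 u) where
  isClosed := isClosed_leastCone 𝒜 u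
  invariant := leastCone_invariant u
  pointed := by
    obtain ⟨C, hC, huC⟩ := hu.exists_proper_mem hB
    have hle := leastCone_le hC.isClosed hC.invariant huC
    rw [eq_bot_iff, ← hC.pointed]
    exact inf_le_inf hle (Submodule.neg_le_neg.2 hle)
  solid := interior_nonempty_of_span_eq_top hu.span_leastCone

theorem mem_dualCone_leastCone (hu : IsConeGenerator 𝒜 u) (hB : IsSelfAdjointForm 𝒜 B) :
    u ∈ dualCone B (leastCone 𝒜 u) :=
  hu.le_dualCone_leastCone hB (hu.isProperInvariantCone_leastCone hB) (mem_leastCone_self 𝒜 u)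
    (mem_leastCone_self 𝒜 u)

/-- The dual is pointed because the least cone spans, and solid because it contains the least cone.
-/
theorem isProperInvariantCone_dualCone (hu : IsConeGenerator 𝒜 u) (hB : IsSelfAdjointForm 𝒜 B) :
    IsProperInvariantCone 𝒜 (dualCone B (leastCone 𝒜 u)) where
  isClosed := isClosed_dualCone B _
  invariant := dualCone_invariant hB (leastCone_invariant u)
  pointed := by
    refine eq_bot_iff.2 fun x hx => ?_
    have hz : ∀ c ∈ leastCone 𝒜 u, B x c = 0 := fun c hc => by
      have h1 := mem_dualCone.1 hx.1 c hc
      have h2 := mem_dualCone.1 (Submodule.mem_neg.1 hx.2) c hc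
      rw [map_neg, LinearMap.neg_apply] at h2
      linarith
    have hle : Submodule.span ℝ (leastCone 𝒜 u : Set V) ≤ LinearMap.ker (B x) :=
      Submodule.span_le.2 fun c hc => hz c hc
    rw [hu.span_leastCone] at hle
    by_contra hne
    exact (hB.posDef x hne).ne' (hle Submodule.mem_top)
  solid := by
    have hp := hu.isProperInvariantCone_leastCone hB
    exact hp.solid.mono (interior_mono (hu.le_dualCone_leastCone hB hp (mem_leastCone_self 𝒜 u)))

/-- Each dual is a proper invariant cone containing `u`, hence is bounded by the other. This
replaces the uniqueness of the invariant form up to scaling. -/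
theorem dualCone_leastCone_congr (hu : IsConeGenerator 𝒜 u) (hB : IsSelfAdjointForm 𝒜 B)
    {B' : LinearMap.BilinForm ℝ V} (hB' : IsSelfAdjointForm 𝒜 B') :
    dualCone B (leastCone 𝒜 u) = dualCone B' (leastCone 𝒜 u) :=
  le_antisymm
    (hu.le_dualCone_leastCone hB' (hu.isProperInvariantCone_dualCone hB)
      (hu.mem_dualCone_leastCone hB))
    (hu.le_dualCone_leastCone hB (hu.isProperInvariantCone_dualCone hB')
      (hu.mem_dualCone_leastCone hB'))

theorem leastCone_le_and_le (hu : IsConeGenerator 𝒜 u) (hB : IsSelfAdjointForm 𝒜 B)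
    {C : PointedCone ℝ V} (hC : IsProperInvariantCone 𝒜 C) :
    (leastCone 𝒜 u ≤ C ∧ C ≤ dualCone B (leastCone 𝒜 u)) ∨
      (leastCone 𝒜 u ≤ -C ∧ -C ≤ dualCone B (leastCone 𝒜 u)) := by
  rcases hu.mem_or_neg_mem hB hC with h | h
  · exact .inl ⟨leastCone_le hC.isClosed hC.invariant h, hu.le_dualCone_leastCone hB hC h⟩
  · have h := Submodule.mem_neg.2 h
    have hC := hC.neg
    exact .inr ⟨leastCone_le hC.isClosed hC.invariant h, hu.le_dualCone_leastCone hB hC h⟩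

theorem maximal_iff (hu : IsConeGenerator 𝒜 u) (hB : IsSelfAdjointForm 𝒜 B)
    {C : PointedCone ℝ V} : Maximal (IsProperInvariantCone 𝒜) C ↔
    C = dualCone B (leastCone 𝒜 u) ∨ C = -dualCone B (leastCone 𝒜 u) := by
  have hp := hu.isProperInvariantCone_dualCone hB
  have hm : Maximal (IsProperInvariantCone 𝒜) (dualCone B (leastCone 𝒜 u)) := by
    refine ⟨hp, fun C hC hle => ?_⟩
    rcases hu.leastCone_le_and_le hB hC with h | h
    · exact h.2
    · refine absurd (h.2 (Submodule.mem_neg.2 ?_)) (hp.not_mem_neg hu.ne_zero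
        (hu.mem_dualCone_leastCone hB))
      rw [neg_neg]
      exact hle (hu.mem_dualCone_leastCone hB)
  constructor
  · intro h
    rcases hu.leastCone_le_and_le hB h.1 with h' | h'
    · exact .inl (h.eq_of_le hp h'.2)
    · exact .inr (h.eq_of_le hp.neg (Submodule.neg_le.1 h'.2))
  · rintro (rfl | rfl)
    · exact hm
    · exact maximal_neg hm

theorem minimal_iff (hu : IsConeGenerator 𝒜 u) (hB : IsSelfAdjointForm 𝒜 B)
    {C : PointedCone ℝ V} : Minimal (IsProperInvariantCone 𝒜) C ↔
    C = leastCone 𝒜 u ∨ C = -leastCone 𝒜 u := by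
  have hp := hu.isProperInvariantCone_leastCone hB
  have hm : Minimal (IsProperInvariantCone 𝒜) (leastCone 𝒜 u) := by
    refine ⟨hp, fun C hC hle => ?_⟩
    rcases hu.leastCone_le_and_le hB hC with h | h
    · exact h.1
    · exact absurd (hle (Submodule.mem_neg.1 (h.1 (mem_leastCone_self 𝒜 u))))
        (hp.not_mem_neg hu.ne_zero (mem_leastCone_self 𝒜 u))
  constructor
  · intro h
    rcases hu.leastCone_le_and_le hB h.1 with h' | h'
    · exact .inl (h.eq_of_ge hp h'.1)
    · exact .inr (h.eq_of_ge hp.neg (Submodule.neg_le.2 h'.1))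
  · rintro (rfl | rfl)
    · exact hm
    · exact minimal_neg hm

end IsConeGenerator

/-- The bipolar theorem for closed cones. -/
theorem dualCone_dualCone [LocallyConvexSpace ℝ V] {B : LinearMap.BilinForm ℝ V}
    (hB : IsSelfAdjointForm 𝒜 B) {C : PointedCone ℝ V}
    (hC : IsClosed (C : Set V)) : dualCone B (dualCone B C) = C := by
  refine le_antisymm (fun x hx => ?_) fun x hx => mem_dualCone.2 fun y hy => by
    rw [hB.symm]; exact mem_dualCone.1 hy x hx
  by_contra hxC
  obtain ⟨f, hf, hfx⟩ := ProperCone.hyperplane_separation_point ⟨C, hC⟩ hxC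
  have hnd : B.Nondegenerate := by
    refine ⟨fun y hy => ?_, fun y hy => ?_⟩ <;>
    · by_contra hne
      exact (hB.posDef y hne).ne' (hy y)
  obtain ⟨y, hy⟩ := (LinearMap.BilinForm.toDual B hnd).surjective (f : V →ₗ[ℝ] ℝ)
  have hy' : ∀ z, B y z = f z := fun z => by
    rw [← LinearMap.BilinForm.toDual_def hnd, hy]; rfl
  have h1 : y ∈ dualCone B C := mem_dualCone.2 fun c hc => by rw [hy']; exact hf c hc
  have h2 := mem_dualCone.1 hx y h1
  rw [hB.symm, hy'] at h2
  linarith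

end Cones

/-! ### Permutations: induction on adjacent descents. -/

section Descents

variable {n : ℕ}

/-- A statistic on permutations that decreases when an adjacent descent is removed. -/
def descentPotential (σ : Perm (Fin n)) : ℕ := ∑ k : Fin n, (n - k) * (σ⁻¹ k : ℕ)

theorem swap_mul_inv_apply (σ : Perm (Fin n)) (i j k : Fin n) :
    (swap i j * σ)⁻¹ k = σ⁻¹ (swap i j k) := by
  simp [mul_inv_rev, Perm.mul_apply]

theorem descentPotential_swap_mul_lt {σ : Perm (Fin n)} {i j : Fin n} (hij : (i : ℕ) + 1 = j)
    (h : σ⁻¹ j < σ⁻¹ i) : descentPotential (swap i j * σ) < descentPotential σ := by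
  have hne : j ≠ i := fun h => by rw [h] at hij; omega
  have hj : j ∈ Finset.univ.erase i := Finset.mem_erase.2 ⟨hne, Finset.mem_univ j⟩
  unfold descentPotential
  rw [← Finset.add_sum_erase _ _ (Finset.mem_univ i), ← Finset.add_sum_erase _ _ hj,
    ← Finset.add_sum_erase _ _ (Finset.mem_univ i), ← Finset.add_sum_erase _ _ hj]
  have hrest : ∑ k ∈ (Finset.univ.erase i).erase j, (n - (k : ℕ)) * ((swap i j * σ)⁻¹ k : ℕ) =
      ∑ k ∈ (Finset.univ.erase i).erase j, (n - (k : ℕ)) * (σ⁻¹ k : ℕ) := by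
    refine Finset.sum_congr rfl fun k hk => ?_
    simp only [Finset.mem_erase, Finset.mem_univ, and_true] at hk
    rw [swap_mul_inv_apply, swap_apply_of_ne_of_ne hk.2 hk.1]
  rw [hrest, swap_mul_inv_apply, swap_mul_inv_apply, swap_apply_left, swap_apply_right]
  -- The weights at `i` and `j` differ by one, so exchanging the two values lowers the sum by `σ⁻¹ i
  -- - σ⁻¹ j`.
  have hd0 : n - (i : ℕ) = (n - (j : ℕ)) + 1 := by omega
  have hlt : (σ⁻¹ j : ℕ) < (σ⁻¹ i : ℕ) := h
  rw [hd0, add_mul, add_mul]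
  omega

theorem eq_one_of_forall_not_descent {σ : Perm (Fin n)}
    (h : ∀ i j : Fin n, (i : ℕ) + 1 = j → ¬ σ⁻¹ j < σ⁻¹ i) : σ = 1 := by
  cases n with
  | zero => exact Subsingleton.elim _ _
  | succ m =>
    have hmono : StrictMono (σ⁻¹ : Perm (Fin (m + 1))) := by
      rw [Fin.strictMono_iff_lt_succ]
      intro i
      refine lt_of_le_of_ne (not_lt.1 (h i.castSucc i.succ (by simp))) fun he => ?_
      exact absurd (σ⁻¹.injective he) (Fin.castSucc_lt_succ).ne
    have hid : ∀ k, σ⁻¹ k = k := fun k =>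
      DFunLike.congr_fun (Subsingleton.elim (hmono.orderIsoOfSurjective _ σ⁻¹.surjective)
        (OrderIso.refl _)) k
    have : σ⁻¹ = 1 := Equiv.ext hid
    exact inv_eq_one.1 this

/-- Induction on permutations by removing adjacent descents. -/
theorem descent_induction {motive : Perm (Fin n) → Prop} (one : motive 1)
    (step : ∀ (σ : Perm (Fin n)) (i j : Fin n), (i : ℕ) + 1 = j → σ⁻¹ j < σ⁻¹ i →
      motive (swap i j * σ) → motive σ) (σ : Perm (Fin n)) : motive σ := by
  induction hN : descentPotential σ using Nat.strong_induction_on generalizing σ with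
  | _ N ih =>
    by_cases h : ∀ i j : Fin n, (i : ℕ) + 1 = j → ¬ σ⁻¹ j < σ⁻¹ i
    · rw [eq_one_of_forall_not_descent h]
      exact one
    · push Not at h
      obtain ⟨i, j, hij, hd⟩ := h
      exact step σ i j hij hd (ih _ (hN ▸ descentPotential_swap_mul_lt hij hd) _ rfl)

/-- The stabilizer of a monotone function is generated by the adjacent transpositions in it. -/
theorem mem_of_forall_adjacent {f : Fin n → ℕ} (hf : Monotone f) {H : Subgroup (Perm (Fin n))}
    (hH : ∀ i j : Fin n, (i : ℕ) + 1 = j → f i = f j → swap i j ∈ H) {σ : Perm (Fin n)}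
    (hσ : ∀ k, f (σ k) = f k) : σ ∈ H := by
  induction σ using descent_induction with
  | one => exact one_mem H
  | step σ i j hij hd ih =>
    have hinv : ∀ k, f (σ⁻¹ k) = f k := fun k => by simpa using (hσ (σ⁻¹ k)).symm
    have hle : i ≤ j := by rw [Fin.le_def]; omega
    -- A descent of `σ` reverses `i` and `j` while `f` is monotone and invariant under `σ⁻¹`, which
    -- forces equality: every descent of `σ` already lies in the stabilizer.
    have he : f i = f j := le_antisymm (hf hle) (by
      rw [← hinv i, ← hinv j]
      exact hf hd.le)
    have hs : ∀ k, f (swap i j k) = f k := fun k => by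
      by_cases hi : k = i
      · rw [hi, swap_apply_left, he]
      by_cases hj : k = j
      · rw [hj, swap_apply_right, he]
      · rw [swap_apply_of_ne_of_ne hi hj]
    have := mul_mem (hH i j hij he) (ih fun k => by rw [Perm.mul_apply, hs, hσ])
    rwa [← mul_assoc, swap_mul_self, one_mul] at this

end Descents

/-! ### Jucys–Murphy elements and their joint eigenvectors. -/

section Seminormal

variable {n : ℕ} {V : Type*} [AddCommGroup V] [Module ℝ V]

/-- The family of operators `1 + s` of a representation, `s` a simple reflection. -/
def onePlus (ρ : Representation ℝ (Perm (Fin n)) V) : Set (Module.End ℝ V) :=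
  {A | ∃ s ∈ simpleReflections n, A = 1 + ρ s}

variable (ρ : Representation ℝ (Perm (Fin n)) V)

theorem swap_apply_swap_apply (i j : Fin n) (v : V) : ρ (swap i j) (ρ (swap i j) v) = v := by
  rw [← Module.End.mul_apply, ← map_mul, swap_mul_self, map_one, Module.End.one_apply]

theorem form_swap_apply {ρ : Representation ℝ (Perm (Fin n)) V} {B : LinearMap.BilinForm ℝ V}
    (hB : IsInvariantInnerForm ρ B) (i j : Fin n) (x y : V) :
    B (ρ (swap i j) x) y = B x (ρ (swap i j) y) := by
  rw [← hB.invariant (swap i j), swap_apply_swap_apply]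

theorem IsInvariantInnerForm.isSelfAdjointForm {ρ : Representation ℝ (Perm (Fin n)) V}
    {B : LinearMap.BilinForm ℝ V} (hB : IsInvariantInnerForm ρ B) :
    IsSelfAdjointForm (onePlus ρ) B where
  symm := hB.symm
  posDef := hB.posDef
  selfAdjoint := by
    rintro _ ⟨_, ⟨i, j, -, rfl⟩, rfl⟩ x y
    simp [form_swap_apply hB]

/-- The Jucys–Murphy element `∑_{i < k} (i k)` acting in a representation. -/
def jucysMurphy (k : Fin n) : Module.End ℝ V := ∑ i ∈ Finset.univ.filter (· < k), ρ (swap i k)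

/-- Conjugation by `s = swap i j` turns each `(m i)` with `m < i` into `(m j)`; the one extra
summand of the element at `j` is `s` itself, and `s² = 1`. -/
theorem jucysMurphy_swap_apply {i j : Fin n} (hij : (i : ℕ) + 1 = j) (v : V) :
    jucysMurphy ρ j (ρ (swap i j) v) = ρ (swap i j) (jucysMurphy ρ i v) + v := by
  have hf : Finset.univ.filter (· < j) = insert i (Finset.univ.filter (· < i)) := by
    ext m
    simp only [Finset.mem_filter, Finset.mem_univ, true_and, Finset.mem_insert, Fin.lt_def,
      Fin.ext_iff]
    omega
  unfold jucysMurphy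
  rw [hf, Finset.sum_insert (by simp), LinearMap.add_apply, swap_apply_swap_apply, add_comm]
  congr 1
  simp only [LinearMap.sum_apply, map_sum]
  refine Finset.sum_congr rfl fun m hm => ?_
  have hm : m < i := by simpa using hm
  have hmj : m ≠ j := fun h => by rw [Fin.lt_def, h] at hm; omega
  simp only [← Module.End.mul_apply, ← map_mul]
  congr 2
  rw [mul_swap_eq_swap_mul (swap i j), swap_apply_left, swap_apply_of_ne_of_ne hm.ne hmj]

theorem jucysMurphy_swap_apply' {i j : Fin n} (hij : (i : ℕ) + 1 = j) (v : V) :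
    jucysMurphy ρ i (ρ (swap i j) v) = ρ (swap i j) (jucysMurphy ρ j v) - v := by
  have h := jucysMurphy_swap_apply ρ hij (ρ (swap i j) v)
  rw [swap_apply_swap_apply] at h
  rw [h, map_add, swap_apply_swap_apply, swap_apply_swap_apply]
  abel

theorem jucysMurphy_swap_apply_of_ne {i j k : Fin n} (hij : (i : ℕ) + 1 = j) (hi : k ≠ i)
    (hj : k ≠ j) (v : V) :
    jucysMurphy ρ k (ρ (swap i j) v) = ρ (swap i j) (jucysMurphy ρ k v) := by
  unfold jucysMurphy
  simp only [LinearMap.sum_apply, map_sum]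
  refine Finset.sum_bij' (fun m _ => swap i j m) (fun m _ => swap i j m) ?_ ?_ (by simp) (by simp)
    ?_
  · intro m hm
    simp only [Finset.mem_filter, Finset.mem_univ, true_and, Fin.lt_def] at hm ⊢
    rw [swap_apply_def]
    split_ifs <;> simp only [Fin.ext_iff] at * <;> omega
  · intro m hm
    simp only [Finset.mem_filter, Finset.mem_univ, true_and, Fin.lt_def] at hm ⊢
    rw [swap_apply_def]
    split_ifs <;> simp only [Fin.ext_iff] at * <;> omega
  · intro m hm
    simp only [← Module.End.mul_apply, ← map_mul]
    rw [mul_swap_eq_swap_mul (swap i j), swap_apply_self, swap_apply_of_ne_of_ne hi hj]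

/-- A joint eigenvector of the Jucys–Murphy elements with eigenvalues `β`. -/
def HasWeight (β : Fin n → ℤ) (v : V) : Prop := ∀ k, jucysMurphy ρ k v = (β k : ℝ) • v

variable {ρ}

theorem HasWeight.zero (β : Fin n → ℤ) : HasWeight ρ β (0 : V) := fun k => by simp

/-- The multiple of `v` is chosen to cancel the extra `± v` in the commutation relations of `swap i
j` with the two neighbouring Jucys–Murphy elements. -/
theorem HasWeight.intertwine {β : Fin n → ℤ} {v : V} (hv : HasWeight ρ β v) {i j : Fin n}
    (hij : (i : ℕ) + 1 = j) (hne : β i ≠ β j) :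
    HasWeight ρ (β ∘ swap i j) (ρ (swap i j) v - (((β j - β i : ℤ) : ℝ))⁻¹ • v) := by
  have hr : ((β j - β i : ℤ) : ℝ) ≠ 0 := by
    exact_mod_cast sub_ne_zero.2 hne.symm
  set c := (((β j - β i : ℤ) : ℝ))⁻¹ with hc
  have hcr : c * ((β j : ℝ) - β i) = 1 := by
    rw [hc]; push_cast at hr ⊢; exact inv_mul_cancel₀ hr
  intro k
  by_cases hi : k = i
  · subst hi
    rw [map_sub, map_smul, jucysMurphy_swap_apply' ρ hij, hv, hv, map_smul, Function.comp_apply,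
      swap_apply_left]
    linear_combination (norm := module) hcr • v
  by_cases hj : k = j
  · subst hj
    rw [map_sub, map_smul, jucysMurphy_swap_apply ρ hij, hv, hv, map_smul, Function.comp_apply,
      swap_apply_right]
    linear_combination (norm := module) (-hcr) • v
  · rw [map_sub, map_smul, jucysMurphy_swap_apply_of_ne ρ hij hi hj, hv, map_smul,
      Function.comp_apply, swap_apply_of_ne_of_ne hi hj]
    module

variable {B : LinearMap.BilinForm ℝ V}

theorem form_jucysMurphy_apply (hB : IsInvariantInnerForm ρ B) (k : Fin n) (x y : V) :
    B (jucysMurphy ρ k x) y = B x (jucysMurphy ρ k y) := by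
  simp only [jucysMurphy, LinearMap.sum_apply, map_sum, form_swap_apply hB]

/-- With `s = swap i j`, evaluating `B (X_j s v) v` on both sides by self-adjointness gives `β B(s
v, v) + B(v, v) = β B(s v, v)`, so `B v v = 0`. -/
theorem HasWeight.eq_zero_of_adjacent (hB : IsInvariantInnerForm ρ B)
    {β : Fin n → ℤ} {v : V} (hv : HasWeight ρ β v) {i j : Fin n}
    (hij : (i : ℕ) + 1 = j) (he : β i = β j) : v = 0 := by
  by_contra hne
  have h1 := form_jucysMurphy_apply hB j (ρ (swap i j) v) v
  rw [jucysMurphy_swap_apply ρ hij, hv, hv, he] at h1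
  simp only [map_add, map_smul, LinearMap.add_apply, LinearMap.smul_apply] at h1
  exact (hB.posDef v hne).ne' (by linarith)

theorem HasWeight.form_eq_zero (hB : IsInvariantInnerForm ρ B)
    {β γ : Fin n → ℤ} {v w : V} (hv : HasWeight ρ β v)
    (hw : HasWeight ρ γ w) (hne : β ≠ γ) : B v w = 0 := by
  obtain ⟨k, hk⟩ := Function.ne_iff.1 hne
  have h := form_jucysMurphy_apply hB k v w
  rw [hv, hw] at h
  simp only [map_smul, LinearMap.smul_apply, smul_eq_mul] at h
  have : ((β k : ℝ) - γ k) * B v w = 0 := by linarith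
  exact (mul_eq_zero.1 this).resolve_left (sub_ne_zero.2 (by exact_mod_cast hk))

end Seminormal

/-- Integrality of the weights enters here; it is the source of all positivity in the seminormal
form. The convention `0⁻¹ = 0` covers `m = 0`. -/
theorem abs_inv_intCast_le_one (m : ℤ) : |((m : ℝ))⁻¹| ≤ 1 := by
  rw [abs_inv]
  rcases eq_or_ne m 0 with rfl | h
  · simp
  · exact inv_le_one_of_one_le₀ (by exact_mod_cast Int.one_le_abs h)

/-! ### Young's seminormal vectors and the existence of a proper invariant cone. -/

section SeminormalVectors

variable {n : ℕ} {V : Type*} [AddCommGroup V] [Module ℝ V]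

open Classical in
/-- Young's seminormal vectors, obtained from a joint eigenvector `v₀` of weight `α` of the
Jucys–Murphy elements by the successive application of intertwiners. -/
def seminormal (ρ : Representation ℝ (Perm (Fin n)) V) (α : Fin n → ℤ) (v₀ : V)
    (σ : Perm (Fin n)) : V :=
  if h : ∃ p : Fin n × Fin n, (p.1 : ℕ) + 1 = p.2 ∧ σ⁻¹ p.2 < σ⁻¹ p.1 then
    ρ (swap h.choose.1 h.choose.2) (seminormal ρ α v₀ (swap h.choose.1 h.choose.2 * σ)) -
      (((α (σ⁻¹ h.choose.1) - α (σ⁻¹ h.choose.2) : ℤ) : ℝ))⁻¹ •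
        seminormal ρ α v₀ (swap h.choose.1 h.choose.2 * σ)
  else v₀
termination_by descentPotential σ
decreasing_by
  all_goals exact descentPotential_swap_mul_lt h.choose_spec.1 h.choose_spec.2

variable {ρ : Representation ℝ (Perm (Fin n)) V} {α : Fin n → ℤ} {v₀ : V}

theorem seminormal_one : seminormal ρ α v₀ 1 = v₀ := by
  rw [seminormal, dif_neg]
  rintro ⟨p, h1, h2⟩
  simp only [inv_one, Perm.one_apply, Fin.lt_def] at h2
  omega

theorem exists_seminormal_eq {σ : Perm (Fin n)} (hσ : σ ≠ 1) :
    ∃ i j : Fin n, (i : ℕ) + 1 = j ∧ σ⁻¹ j < σ⁻¹ i ∧ seminormal ρ α v₀ σ =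
      ρ (swap i j) (seminormal ρ α v₀ (swap i j * σ)) -
        (((α (σ⁻¹ i) - α (σ⁻¹ j) : ℤ) : ℝ))⁻¹ • seminormal ρ α v₀ (swap i j * σ) := by
  have h : ∃ p : Fin n × Fin n, (p.1 : ℕ) + 1 = p.2 ∧ σ⁻¹ p.2 < σ⁻¹ p.1 := by
    by_contra! hc
    exact hσ (eq_one_of_forall_not_descent fun i j hij => not_lt.2 (hc (i, j) hij))
  refine ⟨h.choose.1, h.choose.2, h.choose_spec.1, h.choose_spec.2, ?_⟩
  conv_lhs => rw [seminormal, dif_pos h]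

/-- The Yang–Baxter equation for the intertwiners. -/
theorem intertwiner_braid {s t : Module.End ℝ V} (hs : ∀ v, s (s v) = v) (ht : ∀ v, t (t v) = v)
    (hst : ∀ v, s (t (s v)) = t (s (t v))) {p q r : ℝ} (hpqr : q * (p + r) = p * r)
    {z x₁ x₂ y₁ y₂ : V} (hx₂ : x₂ = s z - r • z) (hx₁ : x₁ = t x₂ - q • x₂)
    (hy₂ : y₂ = t z - p • z) (hy₁ : y₁ = s y₂ - q • y₂) :
    s x₁ - p • x₁ = t y₁ - r • y₁ := by
  subst hx₂ hx₁ hy₂ hy₁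
  simp only [map_sub, map_smul, smul_sub, hs, ht, hst]
  linear_combination (norm := module) hpqr • (s z) - hpqr • (t z)

/-- When the two weights coincide the intertwiner is not defined, but then `v = 0`, so the value
`0⁻¹ = 0` does no harm. -/
theorem HasWeight.seminormal_step {B : LinearMap.BilinForm ℝ V} (hB : IsInvariantInnerForm ρ B)
    {σ : Perm (Fin n)} {i j : Fin n} (hij : (i : ℕ) + 1 = j) {v : V}
    (hv : HasWeight ρ (fun k => α ((swap i j * σ)⁻¹ k)) v) :
    HasWeight ρ (fun k => α (σ⁻¹ k))
      (ρ (swap i j) v - (((α (σ⁻¹ i) - α (σ⁻¹ j) : ℤ) : ℝ))⁻¹ • v) := by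
  by_cases he : α (σ⁻¹ i) = α (σ⁻¹ j)
  · rw [hv.eq_zero_of_adjacent hB hij (by simpa using he.symm)]
    simpa using HasWeight.zero _
  · have h := hv.intertwine hij (by simpa using Ne.symm he)
    convert h using 1
    · funext k
      simp
    · simp

theorem inv_sub_braid {a b c : ℝ} (h1 : a ≠ b) (h2 : a ≠ c) (h3 : b ≠ c) :
    (a - c)⁻¹ * ((a - b)⁻¹ + (b - c)⁻¹) = (a - b)⁻¹ * (b - c)⁻¹ := by
  have h1 := sub_ne_zero.2 h1
  have h2 := sub_ne_zero.2 h2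
  have h3 := sub_ne_zero.2 h3
  field_simp
  ring

theorem swap_braid {i j k : Fin n} (hij : i ≠ j) (hik : i ≠ k) (hjk : j ≠ k) :
    swap i j * swap j k * swap i j = swap j k * swap i j * swap j k := by
  rw [swap_mul_swap_mul_swap hij hik, swap_comm i j, swap_comm j k,
    swap_mul_swap_mul_swap hjk.symm hik.symm, swap_comm]

/-- Seminormal vectors have the expected weights, and do not depend on the order in which the
intertwiners are applied. -/
theorem seminormal_aux {B : LinearMap.BilinForm ℝ V} (hB : IsInvariantInnerForm ρ B)
    (h₀ : HasWeight ρ α v₀) (σ : Perm (Fin n)) :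
    HasWeight ρ (fun k => α (σ⁻¹ k)) (seminormal ρ α v₀ σ) ∧
    ∀ i j : Fin n, (i : ℕ) + 1 = j → σ⁻¹ j < σ⁻¹ i → seminormal ρ α v₀ σ =
      ρ (swap i j) (seminormal ρ α v₀ (swap i j * σ)) -
        (((α (σ⁻¹ i) - α (σ⁻¹ j) : ℤ) : ℝ))⁻¹ • seminormal ρ α v₀ (swap i j * σ) := by
  induction hN : descentPotential σ using Nat.strong_induction_on generalizing σ with
  | _ N ih =>
  subst hN
  by_cases hσ : σ = 1
  · subst hσ
    refine ⟨by simpa [seminormal_one] using h₀, fun i j hij hd => ?_⟩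
    simp only [inv_one, Perm.one_apply, Fin.lt_def] at hd
    omega
  obtain ⟨i, j, hij, hd, hv⟩ := exists_seminormal_eq (ρ := ρ) (α := α) (v₀ := v₀) hσ
  have ih' : ∀ τ, descentPotential τ < descentPotential σ → _ := fun τ hτ => ih _ hτ τ rfl
  clear ih
  have hwt : ∀ τ, descentPotential τ < descentPotential σ →
    HasWeight ρ (fun k => α (τ⁻¹ k)) (seminormal ρ α v₀ τ) := fun τ hτ => (ih' τ hτ).1
  have hst := fun τ (hτ : descentPotential τ < descentPotential σ) => (ih' τ hτ).2
  clear ih'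
  refine ⟨?_, ?_⟩
  · rw [hv]
    exact (hwt _ (descentPotential_swap_mul_lt hij hd)).seminormal_step hB hij
  -- Two descents sharing a letter: both routes are followed for two further steps down to the same
  -- vector `z`, and compared by the Yang–Baxter equation.
  have braid : ∀ i j k : Fin n, (i : ℕ) + 1 = j → (j : ℕ) + 1 = k → σ⁻¹ j < σ⁻¹ i →
      σ⁻¹ k < σ⁻¹ j →
      ρ (swap i j) (seminormal ρ α v₀ (swap i j * σ)) -
        (((α (σ⁻¹ i) - α (σ⁻¹ j) : ℤ) : ℝ))⁻¹ • seminormal ρ α v₀ (swap i j * σ) =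
      ρ (swap j k) (seminormal ρ α v₀ (swap j k * σ)) -
        (((α (σ⁻¹ j) - α (σ⁻¹ k) : ℤ) : ℝ))⁻¹ • seminormal ρ α v₀ (swap j k * σ) := by
    clear hv hd hij i j
    intro i j k hij hjk hji hkj
    have nij : i ≠ j := fun h => by rw [h] at hij; omega
    have njk : j ≠ k := fun h => by rw [h] at hjk; omega
    have nik : i ≠ k := fun h => by rw [h] at hij; omega
    have ei : swap j k i = i := swap_apply_of_ne_of_ne nij nik
    have ek : swap i j k = k := swap_apply_of_ne_of_ne nik.symm njk.symm
    have p1 := descentPotential_swap_mul_lt hij hji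
    have p1' := descentPotential_swap_mul_lt hjk hkj
    have d2 : (swap i j * σ)⁻¹ k < (swap i j * σ)⁻¹ j := by
      simpa [ek] using hkj.trans hji
    have d2' : (swap j k * σ)⁻¹ j < (swap j k * σ)⁻¹ i := by
      simpa [ei] using hkj.trans hji
    have p2 := (descentPotential_swap_mul_lt hjk d2).trans p1
    have p2' := (descentPotential_swap_mul_lt hij d2').trans p1'
    have d3 : (swap j k * (swap i j * σ))⁻¹ j < (swap j k * (swap i j * σ))⁻¹ i := by
      simpa [ek, ei] using hkj
    have d3' : (swap i j * (swap j k * σ))⁻¹ k < (swap i j * (swap j k * σ))⁻¹ j := by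
      simpa [ek, ei] using hji
    have p3 := (descentPotential_swap_mul_lt hij d3).trans p2
    have hz : swap j k * (swap i j * (swap j k * σ)) = swap i j * (swap j k * (swap i j * σ)) := by
      have := swap_braid nij nik njk
      simp only [← mul_assoc, this]
    have hx₁ := hst _ p1 j k hjk d2
    have hx₂ := hst _ p2 i j hij d3
    have hy₁ := hst _ p1' i j hij d2'
    have hy₂ := hst _ p2' j k hjk d3'
    have w2 := hwt _ p2
    have w2' := hwt _ p2'
    have w3 := hwt _ p3
    rw [hz] at hy₂
    simp only [swap_mul_inv_apply, swap_apply_left, swap_apply_right, ei, ek] at hx₁ hx₂ hy₁ hy₂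
    -- If two of the three weights agree, the identity between the inverses may fail, but a vector
    -- on each route has equal neighbouring weights and vanishes, so both sides are zero.
    by_cases hac : α (σ⁻¹ i) = α (σ⁻¹ k)
    · rw [hx₁, hy₁, w2.eq_zero_of_adjacent hB hjk (by simpa [ei, ek] using hac.symm),
        w2'.eq_zero_of_adjacent hB hij (by simpa [ei, ek] using hac.symm)]
      simp
    by_cases hab : α (σ⁻¹ i) = α (σ⁻¹ j)
    · have hz0 := w3.eq_zero_of_adjacent hB hjk (by simpa [ei, ek] using hab.symm)
      rw [hx₁, hy₁, hx₂, hy₂, hz0]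
      simp
    by_cases hbc : α (σ⁻¹ j) = α (σ⁻¹ k)
    · have hz0 := w3.eq_zero_of_adjacent hB hij (by simpa [ei, ek] using hbc.symm)
      rw [hx₁, hy₁, hx₂, hy₂, hz0]
      simp
    refine intertwiner_braid (swap_apply_swap_apply ρ i j) (swap_apply_swap_apply ρ j k) ?_ ?_
      hx₂ hx₁ hy₂ hy₁
    · intro v
      simp only [← Module.End.mul_apply, ← map_mul, swap_braid nij nik njk, ← mul_assoc]
    · push_cast
      exact inv_sub_braid (by exact_mod_cast hab) (by exact_mod_cast hac) (by exact_mod_cast hbc)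
  intro k l hkl hd'
  rw [hv]
  by_cases hik : i = k
  · obtain rfl : j = l := Fin.ext (by rw [← hij, ← hkl, hik])
    rw [hik]
  by_cases hjk : j = k
  · subst hjk
    exact braid i j l hij hkl hd hd'
  by_cases hli : l = i
  · subst hli
    exact (braid k l j hkl hij hd' hd).symm
  -- In the remaining case the two swaps are disjoint, and the two intertwiners commute.
  have hjl : j ≠ l := fun h => hik (Fin.ext (by rw [h] at hij; omega))
  have ei : swap k l i = i := swap_apply_of_ne_of_ne hik (Ne.symm hli)
  have ej : swap k l j = j := swap_apply_of_ne_of_ne hjk hjl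
  have ek : swap i j k = k := swap_apply_of_ne_of_ne (Ne.symm hik) (Ne.symm hjk)
  have el : swap i j l = l := swap_apply_of_ne_of_ne hli hjl.symm
  have hx := hst _ (descentPotential_swap_mul_lt hij hd) k l hkl (by simpa [ek, el] using hd')
  have hy := hst _ (descentPotential_swap_mul_lt hkl hd') i j hij (by simpa [ei, ej] using hd)
  have hcomm : swap i j * swap k l = swap k l * swap i j := by
    rw [mul_swap_eq_swap_mul, ek, el]
  rw [← mul_assoc, hcomm, mul_assoc] at hy
  simp only [swap_mul_inv_apply, ek, el, ei, ej] at hx hy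
  have hc : ∀ v, ρ (swap i j) (ρ (swap k l) v) = ρ (swap k l) (ρ (swap i j) v) := fun v => by
    simp only [← Module.End.mul_apply, ← map_mul, hcomm]
  rw [hx, hy]
  simp only [map_sub, map_smul, hc]
  module

section

variable {B : LinearMap.BilinForm ℝ V}

theorem hasWeight_seminormal (hB : IsInvariantInnerForm ρ B) (h₀ : HasWeight ρ α v₀)
    (σ : Perm (Fin n)) :
    HasWeight ρ (fun k => α (σ⁻¹ k)) (seminormal ρ α v₀ σ) :=
  (seminormal_aux hB h₀ σ).1

theorem seminormal_eq (hB : IsInvariantInnerForm ρ B) (h₀ : HasWeight ρ α v₀)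
    {σ : Perm (Fin n)} {i j : Fin n} (hij : (i : ℕ) + 1 = j)
    (hd : σ⁻¹ j < σ⁻¹ i) : seminormal ρ α v₀ σ =
      ρ (swap i j) (seminormal ρ α v₀ (swap i j * σ)) -
        (((α (σ⁻¹ i) - α (σ⁻¹ j) : ℤ) : ℝ))⁻¹ • seminormal ρ α v₀ (swap i j * σ) :=
  (seminormal_aux hB h₀ σ).2 i j hij hd

/-- On the way from `1` to `σ` the letters `p` and `q` must be exchanged at neighbouring positions.
Just before that, the vector has equal adjacent weights and is zero; later intertwiners keep it
zero. -/
theorem seminormal_eq_zero_of_inversion (hB : IsInvariantInnerForm ρ B) (h₀ : HasWeight ρ α v₀)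
    {σ : Perm (Fin n)} {p q : Fin n} (hpq : p < q)
    (hα : α p = α q) (hσ : σ q < σ p) : seminormal ρ α v₀ σ = 0 := by
  induction σ using descent_induction with
  | one => exact absurd hσ (by simpa using hpq.le)
  | step σ i j hij hd ih =>
    rw [seminormal_eq hB h₀ hij hd]
    suffices h : seminormal ρ α v₀ (swap i j * σ) = 0 by simp [h]
    by_cases hc : σ q = i ∧ σ p = j
    · have hw := hasWeight_seminormal hB h₀ (swap i j * σ)
      refine hw.eq_zero_of_adjacent hB hij ?_
      simp [← hc.1, ← hc.2, hα]
    · apply ih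
      simp only [Perm.mul_apply, swap_apply_def, Fin.lt_def, Fin.ext_iff] at hσ hc ⊢
      split_ifs <;> omega

theorem form_seminormal_eq_zero (hB : IsInvariantInnerForm ρ B) (h₀ : HasWeight ρ α v₀)
    {σ τ : Perm (Fin n)} (hne : σ ≠ τ) :
    B (seminormal ρ α v₀ σ) (seminormal ρ α v₀ τ) = 0 := by
  by_cases hw : (fun k => α (σ⁻¹ k)) = fun k => α (τ⁻¹ k)
  swap
  · exact (hasWeight_seminormal hB h₀ σ).form_eq_zero hB (hasWeight_seminormal hB h₀ τ) hw
  -- If the weights agree, one of the two vectors is zero: at the first difference `k`, the larger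
  -- of the two letters precedes the smaller one, of equal weight, in one of the permutations.
  have key : ∀ (σ τ : Perm (Fin n)) (k : Fin n), (∀ m < k, σ⁻¹ m = τ⁻¹ m) →
      σ⁻¹ k < τ⁻¹ k → α (σ⁻¹ k) = α (τ⁻¹ k) → seminormal ρ α v₀ τ = 0 := by
    intro σ τ k hm hlt hα
    refine seminormal_eq_zero_of_inversion hB h₀ hlt hα ?_
    have h1 : τ (τ⁻¹ k) = k := τ.apply_symm_apply k
    have h2 : ∀ m, τ⁻¹ (τ m) = m := τ.symm_apply_apply
    rw [h1]
    by_contra! hle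
    rcases hle.lt_or_eq with h | h
    · have := hm _ h
      rw [h2] at this
      exact h.ne (σ⁻¹.injective this)
    · have := h2 (σ⁻¹ k)
      rw [h] at this
      exact hlt.ne this.symm
  have hex : ∃ k, σ⁻¹ k ≠ τ⁻¹ k := by
    by_contra! h
    exact hne (inv_injective (Equiv.ext h))
  obtain ⟨k, hk, hmin⟩ := WellFounded.has_min (wellFounded_lt (α := Fin n)) {k | σ⁻¹ k ≠ τ⁻¹ k} hex
  have hm : ∀ m < k, σ⁻¹ m = τ⁻¹ m := fun m hmk => by
    by_contra h
    exact hmin m h hmk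
  rcases lt_or_gt_of_ne (show σ⁻¹ k ≠ τ⁻¹ k from hk) with hlt | hlt
  · rw [key σ τ k hm hlt (congrFun hw k), map_zero]
  · rw [key τ σ k (fun m h => (hm m h).symm) hlt (congrFun hw k).symm, map_zero,
      LinearMap.zero_apply]

/-- The operators `1 + s` have non-negative coefficients on the seminormal vectors. -/
theorem exists_onePlus_seminormal (hB : IsInvariantInnerForm ρ B) (h₀ : HasWeight ρ α v₀)
    (σ : Perm (Fin n)) {i j : Fin n} (hij : (i : ℕ) + 1 = j) :
    ∃ a b : ℝ, 0 ≤ a ∧ 0 ≤ b ∧ (1 + ρ (swap i j)) (seminormal ρ α v₀ σ) =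
      a • seminormal ρ α v₀ σ + b • seminormal ρ α v₀ (swap i j * σ) := by
  by_cases hd : σ⁻¹ j < σ⁻¹ i
  · have h := seminormal_eq hB h₀ hij hd
    have habs := abs_le.1 (abs_inv_intCast_le_one (α (σ⁻¹ i) - α (σ⁻¹ j)))
    set p := (((α (σ⁻¹ i) - α (σ⁻¹ j) : ℤ) : ℝ))⁻¹
    -- From `v = s w - p w` one gets `s v = (1 - p²) w - p v`.
    refine ⟨1 - p, 1 - p ^ 2, by linarith, by nlinarith, ?_⟩
    have h2 := congrArg (ρ (swap i j)) h
    rw [map_sub, map_smul, swap_apply_swap_apply] at h2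
    rw [LinearMap.add_apply, Module.End.one_apply, h2]
    linear_combination (norm := module) p • h
  · have hlt : (swap i j * σ)⁻¹ j < (swap i j * σ)⁻¹ i := by
      simp only [swap_mul_inv_apply, swap_apply_left, swap_apply_right]
      refine lt_of_le_of_ne (not_lt.1 hd) fun h => ?_
      rw [σ⁻¹.injective h] at hij
      omega
    have h := seminormal_eq hB h₀ hij hlt
    rw [← mul_assoc, swap_mul_self, one_mul] at h
    have habs := abs_le.1 (abs_inv_intCast_le_one
      (α ((swap i j * σ)⁻¹ i) - α ((swap i j * σ)⁻¹ j)))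
    set p := (((α ((swap i j * σ)⁻¹ i) - α ((swap i j * σ)⁻¹ j) : ℤ) : ℝ))⁻¹
    refine ⟨1 + p, 1, by linarith, zero_le_one, ?_⟩
    rw [LinearMap.add_apply, Module.End.one_apply]
    linear_combination (norm := module) (-1 : ℝ) • h

/-- A representation generated by a joint eigenvector of the Jucys–Murphy elements with integral
eigenvalues has a proper cone that is invariant under the operators `1 + s`. -/
theorem exists_isProperInvariantCone (hB : IsInvariantInnerForm ρ B) (h₀ : HasWeight ρ α v₀)
    [TopologicalSpace V] [IsTopologicalAddGroup V]
    [ContinuousSMul ℝ V] [T2Space V] [FiniteDimensional ℝ V]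
    (hcyc : ∀ U : Submodule ℝ V, (∀ A ∈ onePlus ρ, ∀ x ∈ U, A x ∈ U) → v₀ ∈ U → U = ⊤) :
    ∃ C, IsProperInvariantCone (onePlus ρ) C := by
  have hspan : Submodule.span ℝ (Set.range (seminormal ρ α v₀)) = ⊤ := by
    refine hcyc _ ?_ (Submodule.subset_span ⟨1, seminormal_one⟩)
    rintro _ ⟨_, ⟨i, j, hij, rfl⟩, rfl⟩ x hx
    have : Submodule.span ℝ (Set.range (seminormal ρ α v₀)) ≤
        (Submodule.span ℝ (Set.range (seminormal ρ α v₀))).comap (1 + ρ (swap i j)) := by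
      refine Submodule.span_le.2 ?_
      rintro _ ⟨σ, rfl⟩
      obtain ⟨a, b, -, -, h⟩ := exists_onePlus_seminormal hB h₀ σ hij
      rw [SetLike.mem_coe, Submodule.mem_comap, h]
      exact add_mem (Submodule.smul_mem _ _ (Submodule.subset_span ⟨_, rfl⟩))
        (Submodule.smul_mem _ _ (Submodule.subset_span ⟨_, rfl⟩))
    exact this hx
  have hmem : ∀ x, x ∈ PointedCone.dual B (Set.range (seminormal ρ α v₀)) ↔
      ∀ σ, 0 ≤ B (seminormal ρ α v₀ σ) x := fun x => by simp [PointedCone.mem_dual]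
  -- The dual of the seminormal cone is automatically closed, and is invariant since each `1 + s` is
  -- self-adjoint and preserves the seminormal cone.
  refine ⟨PointedCone.dual B (Set.range (seminormal ρ α v₀)), ?_, ?_, ?_, ?_⟩
  · exact PointedCone.isClosed_dual fun x => LinearMap.continuous_of_finiteDimensional (B x)
  · rintro _ ⟨_, ⟨i, j, hij, rfl⟩, rfl⟩ x hx
    rw [hmem] at hx ⊢
    intro σ
    rw [← hB.isSelfAdjointForm.selfAdjoint _ ⟨_, ⟨i, j, hij, rfl⟩, rfl⟩]
    obtain ⟨a, b, ha, hb, h⟩ := exists_onePlus_seminormal hB h₀ σ hij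
    rw [h]
    simp only [map_add, map_smul, LinearMap.add_apply, LinearMap.smul_apply, smul_eq_mul]
    exact add_nonneg (mul_nonneg ha (hx _)) (mul_nonneg hb (hx _))
  · refine eq_bot_iff.2 fun x hx => ?_
    have hle : Submodule.span ℝ (Set.range (seminormal ρ α v₀)) ≤ LinearMap.ker (B x) := by
      refine Submodule.span_le.2 ?_
      rintro _ ⟨σ, rfl⟩
      have h1 := (hmem _).1 hx.1 σ
      have h2 := (hmem _).1 (Submodule.mem_neg.1 hx.2) σ
      rw [map_neg] at h2
      rw [SetLike.mem_coe, LinearMap.mem_ker, hB.symm]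
      linarith
    rw [hspan] at hle
    by_contra hne
    exact (hB.posDef x hne).ne' (hle Submodule.mem_top)
  · have hopen : IsOpen {x : V | ∀ σ, seminormal ρ α v₀ σ ≠ 0 → 0 < B (seminormal ρ α v₀ σ) x} := by
      simp only [Set.ofPred_forall]
      exact isOpen_iInter_of_finite fun σ => isOpen_iInter_of_finite fun _ =>
        isOpen_lt continuous_const (LinearMap.continuous_of_finiteDimensional _)
    -- By orthogonality, this sum pairs with each nonzero seminormal vector to its squared length.
    refine ⟨∑ σ, seminormal ρ α v₀ σ, interior_maximal ?_ hopen ?_⟩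
    · intro x hx
      rw [SetLike.mem_coe, hmem]
      intro σ
      by_cases h : seminormal ρ α v₀ σ = 0
      · simp [h]
      · exact (hx σ h).le
    · intro σ hσ
      rw [map_sum, Finset.sum_eq_single σ (fun τ _ hne => form_seminormal_eq_zero hB h₀ hne.symm)
        (by simp)]
      exact hB.posDef _ hσ

end

end SeminormalVectors

/-! ### Averaging over a standard parabolic subgroup inside a closed cone. -/

section Averaging

variable {n : ℕ} {V : Type*} [AddCommGroup V] [Module ℝ V]

variable [TopologicalSpace V] [IsTopologicalAddGroup V] [ContinuousSMul ℝ V] [T2Space V]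
  [FiniteDimensional ℝ V]

theorem continuous_form_self (B : LinearMap.BilinForm ℝ V) : Continuous fun x => B x x := by
  have h : (fun x => B x x) = fun x =>
      ∑ i, (Module.finBasis ℝ V).coord i x * B (Module.finBasis ℝ V i) x := by
    funext x
    have h := congrArg (fun z => B z x) ((Module.finBasis ℝ V).sum_repr x)
    simp only [map_sum, LinearMap.sum_apply, map_smul, LinearMap.smul_apply, smul_eq_mul] at h
    exact h.symm
  rw [h]
  exact continuous_finsetSum _ fun i _ =>
    (LinearMap.continuous_of_finiteDimensional _).mul (LinearMap.continuous_of_finiteDimensional _)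

open Classical in
/-- A closed cone that is invariant under the operators `1 + s` is invariant under the
symmetrizer of a standard parabolic subgroup. -/
theorem sum_stabilizer_mem {ρ : Representation ℝ (Perm (Fin n)) V} {B : LinearMap.BilinForm ℝ V}
    (hB : IsInvariantInnerForm ρ B) {f : Fin n → ℕ} (hf : Monotone f)
    {W : Subgroup (Perm (Fin n))} (hW : ∀ σ, σ ∈ W ↔ ∀ k, f (σ k) = f k) {C : PointedCone ℝ V}
    (hC : IsClosed (C : Set V)) (hinv : ∀ A ∈ onePlus ρ, ∀ x ∈ C, A x ∈ C) {x : V} (hx : x ∈ C) :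
    ∑ w : W, ρ w x ∈ C := by
  set O : Set V := Set.range fun w : W => ρ w x with hO
  have hcomp : IsCompact ((C : Set V) ∩ convexHull ℝ O) :=
    ((Set.finite_range _).isCompact_convexHull (𝕜 := ℝ)).inter_left hC
  have hne : ((C : Set V) ∩ convexHull ℝ O).Nonempty :=
    ⟨x, hx, subset_convexHull ℝ O ⟨1, by simp⟩⟩
  obtain ⟨y, ⟨hyC, hyO⟩, hmin⟩ := hcomp.exists_isMinOn hne (continuous_form_self B).continuousOn
  have hfix : ∀ i j : Fin n, (i : ℕ) + 1 = j → f i = f j → ρ (swap i j) y = y := by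
    intro i j hij he
    have hsW : swap i j ∈ W := (hW _).2 fun k => by
      rw [swap_apply_def]
      split_ifs with h1 h2
      · rw [h1, he]
      · rw [h2, he]
      · rfl
    have hsO : ρ (swap i j) y ∈ convexHull ℝ O := by
      have : ρ (swap i j) y ∈ ρ (swap i j) '' convexHull ℝ O := ⟨y, hyO, rfl⟩
      rw [LinearMap.image_convexHull] at this
      refine convexHull_mono ?_ this
      rintro _ ⟨_, ⟨w, rfl⟩, rfl⟩
      exact ⟨⟨_, hsW⟩ * w, by simp⟩
    have hzO : (1 / 2 : ℝ) • y + (1 / 2 : ℝ) • ρ (swap i j) y ∈ convexHull ℝ O :=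
      convex_convexHull ℝ O hyO hsO (by norm_num) (by norm_num) (by norm_num)
    have hzC : (1 / 2 : ℝ) • y + (1 / 2 : ℝ) • ρ (swap i j) y ∈ C := by
      rw [← smul_add]
      exact C.smul_mem (by norm_num) (hinv _ ⟨_, ⟨i, j, hij, rfl⟩, rfl⟩ y hyC)
    -- By the parallelogram law the midpoint of `y` and `s y` has squared length `|y|² - |s y - y|²
    -- / 4`, so minimality forces `s y = y`.
    have hle := hmin ⟨hzC, hzO⟩
    by_contra hne
    have hpos := hB.posDef _ (sub_ne_zero.2 hne)
    have h1 := hB.invariant (swap i j) y y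
    have h2 := hB.symm (ρ (swap i j) y) y
    simp only [Set.mem_ofPred_eq, map_add, map_sub, map_smul, LinearMap.add_apply,
      LinearMap.sub_apply, LinearMap.smul_apply, smul_eq_mul] at hle hpos
    linarith
  have hfixW : ∀ w ∈ W, ρ w y = y := by
    let H : Subgroup (Perm (Fin n)) :=
      { carrier := {σ | ρ σ y = y}
        one_mem' := by simp
        mul_mem' := fun {a b} (ha : ρ a y = y) (hb : ρ b y = y) => by
          simp [ha, hb]
        inv_mem' := fun {a} (ha : ρ a y = y) => by
          have h : ρ a⁻¹ (ρ a y) = y := by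
            rw [← Module.End.mul_apply, ← map_mul, inv_mul_cancel, map_one, Module.End.one_apply]
          rwa [ha] at h }
    exact fun w hw => mem_of_forall_adjacent hf (H := H) hfix ((hW w).1 hw)
  -- The sum over `W` is linear and constant on the orbit of `x`, hence constant on its convex hull.
  have hsum : ∑ w : W, ρ w y = ∑ w : W, ρ w x := by
    have hconv : Convex ℝ (⇑(∑ w : W, ρ w : Module.End ℝ V) ⁻¹' {∑ w : W, ρ w x}) :=
      (convex_singleton _).linear_preimage _
    have hsub : O ⊆ ⇑(∑ w : W, ρ w : Module.End ℝ V) ⁻¹' {∑ w : W, ρ w x} := by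
      rintro _ ⟨v, rfl⟩
      simp only [Set.mem_preimage, LinearMap.sum_apply, Set.mem_singleton_iff]
      refine Fintype.sum_equiv (Equiv.mulRight v) _ _ fun w => ?_
      simp
    simpa using convexHull_min hsub hconv hyO
  rw [← hsum, Fintype.sum_congr _ _ fun w : W => hfixW w w.2, Finset.sum_const,
    ← Nat.cast_smul_eq_nsmul ℝ]
  exact C.smul_mem (Nat.cast_nonneg _) hyC

end Averaging

/-! ### Tableaux: reading orders, column sorting and the invariant form. -/

section Tableaux

variable {lam : YoungDiagram} {n : ℕ}

namespace Tableau

theorem cell_mem (T : Tableau lam n) (k : Fin n) : (T.row k, T.col k) ∈ lam :=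
  (YoungDiagram.mem_cells _).1 (T.symm k).2

/-- The entry of a tableau in a given box. -/
def entry (T : Tableau lam n) {r c : ℕ} (h : (r, c) ∈ lam) : Fin n :=
  Equiv.toFun T ⟨(r, c), (YoungDiagram.mem_cells _).2 h⟩

theorem row_entry (T : Tableau lam n) {r c : ℕ} (h : (r, c) ∈ lam) : T.row (T.entry h) = r :=
  congrArg (fun c => c.1.1) (T.left_inv _)

theorem col_entry (T : Tableau lam n) {r c : ℕ} (h : (r, c) ∈ lam) : T.col (T.entry h) = c :=
  congrArg (fun c => c.1.2) (T.left_inv _)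

theorem eq_of_row_eq_of_col_eq (T : Tableau lam n) {k l : Fin n} (hr : T.row k = T.row l)
    (hc : T.col k = T.col l) : k = l :=
  T.symm.injective (Subtype.ext (Prod.ext hr hc))

/-- The permutation that carries one tableau to another. -/
def transport (T T' : Tableau lam n) : Perm (Fin n) := Equiv.trans T.symm T'

theorem transport_smul (T T' : Tableau lam n) : transport T T' • T = T' :=
  Equiv.ext fun c => congrArg (Equiv.toFun T') (T.left_inv c)

theorem transport_transport (T T' : Tableau lam n) (k : Fin n) :
    transport T' T (transport T T' k) = k :=
  (congrArg (Equiv.toFun T) (T'.left_inv _)).trans (T.right_inv k)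

theorem row_smul_apply (σ : Perm (Fin n)) (T : Tableau lam n) (k : Fin n) :
    (σ • T).row (σ k) = T.row k := by
  rw [row_smul, Perm.inv_def, symm_apply_apply]

theorem col_smul_apply (σ : Perm (Fin n)) (T : Tableau lam n) (k : Fin n) :
    (σ • T).col (σ k) = T.col k := by
  rw [col_smul, Perm.inv_def, symm_apply_apply]

theorem row_transport (T T' : Tableau lam n) (k : Fin n) :
    T'.row (transport T T' k) = T.row k := by
  have := row_smul_apply (transport T T') T k
  rwa [transport_smul] at this

theorem col_transport (T T' : Tableau lam n) (k : Fin n) :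
    T'.col (transport T T' k) = T.col k := by
  have := col_smul_apply (transport T T') T k
  rwa [transport_smul] at this

theorem tabloid_eq_iff {T T' : Tableau lam n} :
    T.tabloid = T'.tabloid ↔ ∀ k, T.row k = T'.row k := by
  constructor
  · intro h
    obtain ⟨σ, hσ, rfl⟩ := Quotient.exact h
    intro k
    rw [row_smul]
    exact (inv_mem hσ k).symm
  · intro h
    refine Quotient.sound ⟨transport T T', fun k => ?_, (transport_smul T T').symm⟩
    rw [h, row_transport]

/-- There is a tableau whose entries follow a given linear order on the boxes. -/
theorem exists_le_iff_le (hlam : lam.card = n) {L : Type*} [LinearOrder L] {g : ℕ × ℕ → L}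
    (hg : Function.Injective g) :
    ∃ T : Tableau lam n, ∀ i k, g (T.row i, T.col i) ≤ g (T.row k, T.col k) ↔ i ≤ k := by
  have hcard : (lam.cells.map ⟨g, hg⟩).card = n := by rw [Finset.card_map]; exact hlam
  let iso := (lam.cells.map ⟨g, hg⟩).orderIsoOfFin hcard
  let e : {c // c ∈ lam.cells} ≃ {x // x ∈ lam.cells.map ⟨g, hg⟩} :=
    Equiv.ofBijective (fun c => ⟨g c, Finset.mem_map_of_mem ⟨g, hg⟩ c.2⟩) ⟨fun a b h =>
      Subtype.ext (hg (congrArg Subtype.val h)), fun ⟨x, hx⟩ => by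
        obtain ⟨c, hc, rfl⟩ := Finset.mem_map.1 hx
        exact ⟨⟨c, hc⟩, rfl⟩⟩
  let T : Tableau lam n := e.trans iso.symm.toEquiv
  have hT : ∀ k, g (T.row k, T.col k) = (iso k : L) := fun k => by
    have : e (e.symm (iso k)) = iso k := e.apply_symm_apply _
    exact congrArg Subtype.val this
  exact ⟨T, fun i k => by rw [hT, hT, Subtype.coe_le_coe, iso.le_iff_le]⟩

/-- Monotone rows make the row stabilizer a standard parabolic subgroup, as `sum_stabilizer_mem`
requires. -/
theorem exists_row_monotone (hlam : lam.card = n) : ∃ T : Tableau lam n, Monotone T.row := by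
  obtain ⟨T, hT⟩ := exists_le_iff_le hlam (toLex (α := ℕ × ℕ)).injective
  refine ⟨T, fun i k hik => ?_⟩
  have := (hT i k).2 hik
  rw [Prod.Lex.toLex_le_toLex] at this
  rcases this with h | h
  · exact h.le
  · exact h.1.le

/-- This is the column reading tableau, whose polytabloid starts the seminormal construction. -/
theorem exists_lt_iff_col_lt (hlam : lam.card = n) : ∃ T : Tableau lam n, ∀ i k,
    i < k ↔ T.col i < T.col k ∨ T.col i = T.col k ∧ T.row i < T.row k := by
  obtain ⟨T, hT⟩ := exists_le_iff_le hlam (g := fun c => toLex (c.2, c.1)) fun a b h => by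
    have := toLex.injective h
    simp only [Prod.mk.injEq] at this
    exact Prod.ext this.2 this.1
  refine ⟨T, fun i k => ?_⟩
  rw [← not_le, ← hT, not_le, Prod.Lex.toLex_lt_toLex]

section Sorting

variable {T T' : Tableau lam n}

open Classical in
theorem card_filter_row_lt_eq (r : ℕ) :
    (Finset.univ.filter fun k => T'.row k < r).card =
      (Finset.univ.filter fun k => T.row k < r).card := by
  refine Finset.card_bij' (fun k _ => transport T' T k) (fun k _ => transport T T' k) ?_ ?_ ?_ ?_
  · intro k hk
    simpa [row_transport] using hk
  · intro k hk
    simpa [row_transport] using hk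
  · intro k _
    exact transport_transport _ _ k
  · intro k _
    exact transport_transport _ _ k

theorem card_filter_col_row_lt_le
    (h : ∀ p q, T'.row p = T'.row q → T.col p = T.col q → p = q) (j r : ℕ) :
    (Finset.univ.filter fun k => T'.row k < r ∧ T.col k = j).card ≤
      (Finset.univ.filter fun k => T.row k < r ∧ T.col k = j).card := by
  rcases le_or_gt r (lam.colLen j) with hr | hr
  · calc (Finset.univ.filter fun k => T'.row k < r ∧ T.col k = j).card
        ≤ (Finset.range r).card := by
          refine Finset.card_le_card_of_injOn T'.row ?_ ?_
          · intro k hk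
            simp only [Finset.coe_filter, Finset.mem_univ, true_and, Set.mem_ofPred_eq] at hk
            simpa using hk.1
          · intro p hp q hq hpq
            simp only [Finset.coe_filter, Finset.mem_univ, true_and, Set.mem_ofPred_eq] at hp hq
            exact h p q hpq (hp.2.trans hq.2.symm)
      _ ≤ (Finset.univ.filter fun k => T.row k < r ∧ T.col k = j).card := by
          have hmem : ∀ i : Finset.range r, ((i : ℕ), j) ∈ lam := fun i =>
            YoungDiagram.mem_iff_lt_colLen.2 ((Finset.mem_range.1 i.2).trans_le hr)
          rw [← Finset.card_attach]
          refine Finset.card_le_card_of_injOn (fun i => T.entry (hmem i)) ?_ ?_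
          · intro i _
            simp [row_entry, col_entry, Finset.mem_range.1 i.2]
          · intro a _ b _ hab
            have := congrArg T.row hab
            simp only [row_entry] at this
            exact Subtype.ext this
  · refine Finset.card_le_card fun k hk => ?_
    simp only [Finset.mem_filter, Finset.mem_univ, true_and] at hk ⊢
    refine ⟨lt_trans ?_ hr, hk.2⟩
    rw [← hk.2]
    exact YoungDiagram.mem_iff_lt_colLen.1 (T.cell_mem k)

/-- The first `r` rows of `T'` hold at most as many entries of each column of `T` as the first `r`
rows of `T` do, and the totals agree, so equality holds columnwise. Taking `r` to be the length of a
column places all its entries in the first `r` rows of `T'`. -/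
theorem row_col_mem_of_injective
    (h : ∀ p q, T'.row p = T'.row q → T.col p = T.col q → p = q) (k : Fin n) :
    (T'.row k, T.col k) ∈ lam := by
  classical
  rw [YoungDiagram.mem_iff_lt_colLen]
  set r := lam.colLen (T.col k) with hr
  have hsum : ∀ S : Tableau lam n, (Finset.univ.filter fun l => S.row l < r).card =
      ∑ j ∈ Finset.univ.image T.col,
        (Finset.univ.filter fun l => S.row l < r ∧ T.col l = j).card := fun S => by
    rw [Finset.card_eq_sum_card_fiberwise (f := T.col) (t := Finset.univ.image T.col)
      fun l _ => Finset.mem_coe.2 (Finset.mem_image_of_mem _ (Finset.mem_univ l))]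
    simp only [Finset.filter_filter]
  have heq := card_filter_row_lt_eq (T := T) (T' := T') r
  rw [hsum T', hsum T, Finset.sum_eq_sum_iff_of_le
    fun j _ => card_filter_col_row_lt_le h j r] at heq
  have hk := heq _ (Finset.mem_image_of_mem _ (Finset.mem_univ k))
  have hfull : (Finset.univ.filter fun l => T.row l < r ∧ T.col l = T.col k) =
      Finset.univ.filter fun l => T.col l = T.col k := by
    ext l
    simp only [Finset.mem_filter, Finset.mem_univ, true_and, and_iff_right_iff_imp]
    intro hl
    rw [hr, ← hl]
    exact YoungDiagram.mem_iff_lt_colLen.1 (T.cell_mem l)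
  rw [hfull] at hk
  have hsub : (Finset.univ.filter fun l => T'.row l < r ∧ T.col l = T.col k) ⊆
      Finset.univ.filter fun l => T.col l = T.col k := fun l hl => by
    simp only [Finset.mem_filter, Finset.mem_univ, true_and] at hl ⊢
    exact hl.2
  have := Finset.eq_of_subset_of_card_le hsub hk.ge
  have hmem : k ∈ Finset.univ.filter fun l => T.col l = T.col k := by simp
  rw [← this] at hmem
  simp only [Finset.mem_filter, Finset.mem_univ, true_and] at hmem
  exact hmem.1

/-- For two tableaux of the same shape, either two entries are in the same row of the second and
in the same column of the first, or a column permutation of the first has the tabloid of the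
second. -/
theorem exists_pair_or_exists_colStabilizer (T T' : Tableau lam n) :
    (∃ p q, p ≠ q ∧ T'.row p = T'.row q ∧ T.col p = T.col q) ∨
      ∃ σ ∈ T.colStabilizer, (σ • T).tabloid = T'.tabloid := by
  by_cases h : ∀ p q, T'.row p = T'.row q → T.col p = T.col q → p = q
  swap
  · push Not at h
    obtain ⟨p, q, h1, h2, h3⟩ := h
    exact .inl ⟨p, q, h3, h1, h2⟩
  right
  -- Combining rows of `T'` with columns of `T` gives a tableau `S` that has the tabloid of `T'` and
  -- is a column permutation of `T`.
  let f : Fin n → {c // c ∈ lam.cells} := fun k =>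
    ⟨(T'.row k, T.col k), (YoungDiagram.mem_cells _).2 (row_col_mem_of_injective h k)⟩
  have hf : Function.Bijective f := by
    rw [Fintype.bijective_iff_injective_and_card]
    refine ⟨fun p q hpq => ?_, (Fintype.card_congr T).symm⟩
    have := congrArg Subtype.val hpq
    simp only [f, Prod.mk.injEq] at this
    exact h p q this.1 this.2
  let S : Tableau lam n := (Equiv.ofBijective f hf).symm
  have hrow : ∀ k, S.row k = T'.row k := fun k => rfl
  have hcol : ∀ k, S.col k = T.col k := fun k => rfl
  refine ⟨transport T S, fun k => ?_, ?_⟩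
  · rw [← hcol, col_transport]
  · rw [transport_smul]
    exact tabloid_eq_iff.2 hrow

end Sorting

theorem swap_mem_colStabilizer {T : Tableau lam n} {p q : Fin n} (h : T.col p = T.col q) :
    swap p q ∈ T.colStabilizer := fun k => by
  rw [swap_apply_def]
  split_ifs with h1 h2
  · rw [h1, h]
  · rw [h2, h]
  · rfl

theorem swap_mem_rowStabilizer {T : Tableau lam n} {p q : Fin n} (h : T.row p = T.row q) :
    swap p q ∈ T.rowStabilizer := fun k => by
  rw [swap_apply_def]
  split_ifs with h1 h2
  · rw [h1, h]
  · rw [h2, h]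
  · rfl

theorem smul_tabloid_eq_iff {T : Tableau lam n} {σ : Perm (Fin n)} :
    σ • T.tabloid = T.tabloid ↔ σ ∈ T.rowStabilizer := by
  rw [smul_tabloid, tabloid_eq_iff, mem_rowStabilizer]
  constructor
  · intro h k
    rw [← h (σ k), row_smul_apply]
  · intro h k
    rw [row_smul, ← h (σ⁻¹ k), Perm.inv_def, apply_symm_apply]

end Tableau

instance : Finite (Tableau lam n) :=
  inferInstanceAs (Finite ({c // c ∈ lam.cells} ≃ Fin n))

instance : Finite (Tabloid lam n) :=
  inferInstanceAs (Finite (Quotient (Tableau.rowSetoid lam n)))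

instance : Fintype (Tabloid lam n) := Fintype.ofFinite _

section Forms

/-- The bilinear form on `M^lam` for which the tabloids are orthonormal. -/
def tabloidForm (lam : YoungDiagram) (n : ℕ) : LinearMap.BilinForm ℝ (TabloidModule lam n) :=
  LinearMap.mk₂ ℝ (fun x y => ∑ t, x t * y t)
    (fun x x' y => by simp [add_mul, Finset.sum_add_distrib])
    (fun c x y => by simp [Finset.mul_sum, mul_assoc])
    (fun x y y' => by simp [mul_add, Finset.sum_add_distrib])
    (fun c x y => by simp [Finset.mul_sum, mul_left_comm])

theorem tabloidForm_apply (x y : TabloidModule lam n) :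
    tabloidForm lam n x y = ∑ t, x t * y t := rfl

theorem tabloidForm_tabloidVec (x : TabloidModule lam n) (t : Tabloid lam n) :
    tabloidForm lam n x (tabloidVec t) = x t := by
  classical
  simp [tabloidForm_apply, tabloidVec, Pi.single_apply]

theorem isInvariantInnerForm_tabloidForm :
    IsInvariantInnerForm (tabloidRep lam n) (tabloidForm lam n) where
  symm x y := by simp only [tabloidForm_apply, mul_comm]
  posDef x hx := by
    obtain ⟨t, ht⟩ := Function.ne_iff.1 hx
    exact Finset.sum_pos' (fun t _ => mul_self_nonneg _)
      ⟨t, Finset.mem_univ t, mul_self_pos.2 ht⟩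
  invariant σ x y := Fintype.sum_equiv (MulAction.toPerm σ⁻¹) _ _ fun t => rfl

/-- The restriction of `tabloidForm` to the Specht module. -/
def spechtForm (lam : YoungDiagram) (n : ℕ) : LinearMap.BilinForm ℝ (specht lam n) :=
  (tabloidForm lam n).compl₁₂ (specht lam n).subtype (specht lam n).subtype

theorem isInvariantInnerForm_spechtForm :
    IsInvariantInnerForm (spechtRep lam n) (spechtForm lam n) where
  symm x y := isInvariantInnerForm_tabloidForm.symm x.1 y.1
  posDef x hx := isInvariantInnerForm_tabloidForm.posDef x.1 (by simpa using hx)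
  invariant σ x y := isInvariantInnerForm_tabloidForm.invariant σ x.1 y.1

end Forms

end Tableaux

theorem sign_mul_self_real {n : ℕ} (σ : Perm (Fin n)) :
    ((Perm.sign σ : ℤ) : ℝ) * ((Perm.sign σ : ℤ) : ℝ) = 1 := by
  rw [← Int.cast_mul, ← Units.val_mul, Int.units_mul_self]
  simp

/-! ### Symmetrizers of subgroups and generation by simple reflections. -/

section Symmetrizers

variable {n : ℕ} {V : Type*} [AddCommGroup V] [Module ℝ V]
  (ρ : Representation ℝ (Perm (Fin n)) V) (W : Subgroup (Perm (Fin n)))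

open Classical in
/-- The sum of the elements of a subgroup. -/
def symmetrizer : Module.End ℝ V := ∑ w : W, ρ w

open Classical in
/-- The signed sum of the elements of a subgroup. -/
def antisymmetrizer : Module.End ℝ V :=
  ∑ w : W, ((Perm.sign (w : Perm (Fin n)) : ℤ) : ℝ) • ρ w

variable {W}

theorem symmetrizer_apply_of_mem {σ : Perm (Fin n)} (hσ : σ ∈ W) (x : V) :
    symmetrizer ρ W (ρ σ x) = symmetrizer ρ W x := by
  classical
  simp only [symmetrizer, LinearMap.sum_apply]
  exact Fintype.sum_equiv (Equiv.mulRight (⟨σ, hσ⟩ : W)) _ _ fun w => by simp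

theorem apply_symmetrizer_of_mem {σ : Perm (Fin n)} (hσ : σ ∈ W) (x : V) :
    ρ σ (symmetrizer ρ W x) = symmetrizer ρ W x := by
  classical
  simp only [symmetrizer, LinearMap.sum_apply, map_sum]
  exact Fintype.sum_equiv (Equiv.mulLeft (⟨σ, hσ⟩ : W)) _ _ fun w => by simp

theorem symmetrizer_of_forall_apply_eq {x : V} (hx : ∀ w ∈ W, ρ w x = x) :
    symmetrizer ρ W x = (Nat.card W : ℝ) • x := by
  classical
  simp only [symmetrizer, LinearMap.sum_apply]
  rw [Fintype.sum_congr _ _ fun w : W => hx w w.2, Finset.sum_const, ← Nat.cast_smul_eq_nsmul ℝ,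
    Finset.card_univ, Nat.card_eq_fintype_card]

theorem antisymmetrizer_apply_of_mem {σ : Perm (Fin n)} (hσ : σ ∈ W) (x : V) :
    antisymmetrizer ρ W (ρ σ x) =
      ((Perm.sign σ : ℤ) : ℝ) • antisymmetrizer ρ W x := by
  classical
  simp only [antisymmetrizer, LinearMap.sum_apply, Finset.smul_sum, LinearMap.smul_apply]
  refine Fintype.sum_equiv (Equiv.mulRight (⟨σ, hσ⟩ : W)) _ _ fun w => ?_
  simp only [Equiv.coe_mulRight, Subgroup.coe_mul, map_mul, Module.End.mul_apply, smul_smul,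
    Units.val_mul, Int.cast_mul]
  congr 1
  linear_combination (-((Perm.sign (w : Perm (Fin n)) : ℤ) : ℝ)) * sign_mul_self_real σ

variable {ρ} {B : LinearMap.BilinForm ℝ V}

theorem form_apply_left (hB : IsInvariantInnerForm ρ B) (σ : Perm (Fin n)) (x y : V) :
    B (ρ σ x) y = B x (ρ σ⁻¹ y) := by
  have h : ρ σ (ρ σ⁻¹ y) = y := by
    rw [← Module.End.mul_apply, ← map_mul, mul_inv_cancel, map_one, Module.End.one_apply]
  rw [← hB.invariant σ x, h]

theorem form_symmetrizer (hB : IsInvariantInnerForm ρ B) (x y : V) :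
    B (symmetrizer ρ W x) y = B x (symmetrizer ρ W y) := by
  classical
  simp only [symmetrizer, LinearMap.sum_apply, map_sum]
  exact Fintype.sum_equiv (Equiv.inv W) _ _ fun w => by simp [form_apply_left hB]

theorem form_antisymmetrizer (hB : IsInvariantInnerForm ρ B) (x y : V) :
    B (antisymmetrizer ρ W x) y = B x (antisymmetrizer ρ W y) := by
  classical
  simp only [antisymmetrizer, LinearMap.sum_apply, map_sum, LinearMap.smul_apply, map_smul]
  exact Fintype.sum_equiv (Equiv.inv W) _ _ fun w => by simp [form_apply_left hB]

/-- The simple reflections generate the symmetric group. -/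
theorem mem_of_simpleReflections_subset {H : Subgroup (Perm (Fin n))}
    (hH : simpleReflections n ⊆ H) (σ : Perm (Fin n)) : σ ∈ H :=
  mem_of_forall_adjacent (f := fun _ => 0) monotone_const
    (fun i j hij _ => hH ⟨i, j, hij, rfl⟩) fun _ => rfl

/-- A self-adjoint involution is an isometry, and the simple reflections generate the group. -/
theorem IsSelfAdjointForm.isInvariantInnerForm (hB : IsSelfAdjointForm (onePlus ρ) B) :
    IsInvariantInnerForm ρ B where
  symm := hB.symm
  posDef := hB.posDef
  invariant σ := by
    let H : Subgroup (Perm (Fin n)) :=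
      { carrier := {σ | ∀ x y, B (ρ σ x) (ρ σ y) = B x y}
        one_mem' := by simp
        mul_mem' := fun {a b} ha hb x y => by
          rw [map_mul, Module.End.mul_apply, Module.End.mul_apply]
          exact (ha _ _).trans (hb _ _)
        inv_mem' := fun {a} ha x y => by
          have h := ha (ρ a⁻¹ x) (ρ a⁻¹ y)
          simp only [← Module.End.mul_apply, ← map_mul, mul_inv_cancel, map_one,
            Module.End.one_apply] at h
          exact h.symm }
    refine mem_of_simpleReflections_subset (H := H) ?_ σ
    rintro _ ⟨i, j, hij, rfl⟩ x y
    have h := hB.selfAdjoint _ ⟨_, ⟨i, j, hij, rfl⟩, rfl⟩ x (ρ (swap i j) y)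
    simp only [LinearMap.add_apply, Module.End.one_apply, map_add, swap_apply_swap_apply] at h
    linarith

theorem apply_mem_of_onePlus_invariant {U : Submodule ℝ V}
    (hU : ∀ A ∈ onePlus ρ, ∀ x ∈ U, A x ∈ U) (σ : Perm (Fin n)) {x : V} (hx : x ∈ U) :
    ρ σ x ∈ U := by
  let H : Subgroup (Perm (Fin n)) :=
    { carrier := {σ | ∀ x, ρ σ x ∈ U ↔ x ∈ U}
      one_mem' := by simp
      mul_mem' := fun {a b} ha hb x => by
        rw [map_mul, Module.End.mul_apply]
        exact (ha _).trans (hb _)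
      inv_mem' := fun {a} ha x => by
        have h := ha (ρ a⁻¹ x)
        simp only [← Module.End.mul_apply, ← map_mul, mul_inv_cancel, map_one,
          Module.End.one_apply] at h
        exact h.symm }
  refine (mem_of_simpleReflections_subset (H := H) ?_ σ x).2 hx
  rintro _ ⟨i, j, hij, rfl⟩
  have key : ∀ x ∈ U, ρ (swap i j) x ∈ U := fun x hx => by
    have h := sub_mem (hU _ ⟨_, ⟨i, j, hij, rfl⟩, rfl⟩ x hx) hx
    simpa using h
  exact fun x => ⟨fun h => by simpa [swap_apply_swap_apply] using key _ h, key x⟩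

end Symmetrizers

/-! ### Polytabloids: the row and column symmetrizers have rank one. -/

section Polytabloids

variable {lam : YoungDiagram} {n : ℕ}

theorem polytabloid_eq_antisymmetrizer (T : Tableau lam n) :
    polytabloid T = antisymmetrizer (tabloidRep lam n) T.colStabilizer (tabloidVec T.tabloid) := by
  simp only [polytabloid, antisymmetrizer, LinearMap.sum_apply, LinearMap.smul_apply]

theorem tabloidRep_polytabloid_of_mem {T : Tableau lam n} {σ : Perm (Fin n)}
    (hσ : σ ∈ T.colStabilizer) :
    tabloidRep lam n σ (polytabloid T) = ((Perm.sign σ : ℤ) : ℝ) • polytabloid T := by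
  classical
  simp only [polytabloid, map_sum, Finset.smul_sum, map_smul]
  refine Fintype.sum_equiv (Equiv.mulLeft (⟨σ, hσ⟩ : T.colStabilizer)) _ _ fun w => ?_
  simp only [Equiv.coe_mulLeft, Subgroup.coe_mul, map_mul, Module.End.mul_apply, smul_smul,
    Units.val_mul, Int.cast_mul]
  rw [← mul_assoc, sign_mul_self_real, one_mul]

theorem eq_zero_of_eq_neg_one_smul {V : Type*} [AddCommGroup V] [Module ℝ V] {x : V}
    (h : x = (-1 : ℝ) • x) : x = 0 := by
  have : (2 : ℝ) • x = 0 := by linear_combination (norm := module) h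
  exact (smul_eq_zero.1 this).resolve_left two_ne_zero

theorem span_tabloidVec : Submodule.span ℝ (Set.range (tabloidVec (lam := lam) (n := n))) = ⊤ := by
  classical
  refine eq_top_iff.2 fun x _ => ?_
  have hx : x = ∑ t, x t • tabloidVec t := by
    ext u
    simp [tabloidVec, Pi.single_apply]
  rw [hx]
  exact Submodule.sum_mem _ fun t _ =>
    Submodule.smul_mem _ _ (Submodule.subset_span ⟨t, rfl⟩)

/-- The signed column symmetrizer maps `M^lam` to the line of the polytabloid. -/
theorem antisymmetrizer_mem_span (T : Tableau lam n) (x : TabloidModule lam n) :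
    antisymmetrizer (tabloidRep lam n) T.colStabilizer x ∈ Submodule.span ℝ {polytabloid T} := by
  have hle : Submodule.span ℝ (Set.range (tabloidVec (lam := lam) (n := n))) ≤
      (Submodule.span ℝ {polytabloid T}).comap
        (antisymmetrizer (tabloidRep lam n) T.colStabilizer) := by
    refine Submodule.span_le.2 ?_
    rintro _ ⟨t, rfl⟩
    obtain ⟨T', rfl⟩ := Quotient.exists_rep t
    change antisymmetrizer (tabloidRep lam n) T.colStabilizer (tabloidVec T'.tabloid) ∈
      Submodule.span ℝ {polytabloid T}
    rcases Tableau.exists_pair_or_exists_colStabilizer T T' with ⟨p, q, hpq, hr, hc⟩ | ⟨σ, hσ, h⟩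
    · have h := antisymmetrizer_apply_of_mem (tabloidRep lam n)
        (Tableau.swap_mem_colStabilizer hc) (tabloidVec T'.tabloid)
      rw [tabloidRep_tabloidVec, Tableau.smul_tabloid_eq_iff.2 (Tableau.swap_mem_rowStabilizer hr),
        Perm.sign_swap hpq] at h
      -- The swap fixes the tabloid but changes the sign of its antisymmetrization.
      rw [eq_zero_of_eq_neg_one_smul (x := antisymmetrizer _ _ (tabloidVec T'.tabloid))
        (by simpa using h)]
      exact zero_mem _
    · rw [← h, ← Tableau.smul_tabloid, ← tabloidRep_tabloidVec, antisymmetrizer_apply_of_mem _ hσ,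
        ← polytabloid_eq_antisymmetrizer]
      exact Submodule.smul_mem _ _ (Submodule.mem_span_singleton_self _)
  rw [span_tabloidVec] at hle
  exact hle Submodule.mem_top

/-- The row symmetrizer maps the Specht module to a line. -/
theorem symmetrizer_mem_span (T : Tableau lam n) {x : TabloidModule lam n}
    (hx : x ∈ specht lam n) : symmetrizer (tabloidRep lam n) T.rowStabilizer x ∈
      Submodule.span ℝ {symmetrizer (tabloidRep lam n) T.rowStabilizer (polytabloid T)} := by
  have hle : specht lam n ≤ (Submodule.span ℝ {symmetrizer (tabloidRep lam n) T.rowStabilizer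
      (polytabloid T)}).comap (symmetrizer (tabloidRep lam n) T.rowStabilizer) := by
    refine Submodule.span_le.2 ?_
    rintro _ ⟨T', rfl⟩
    rw [SetLike.mem_coe, Submodule.mem_comap]
    rcases Tableau.exists_pair_or_exists_colStabilizer T' T with ⟨p, q, hpq, hr, hc⟩ | ⟨σ, hσ, h⟩
    · have h := symmetrizer_apply_of_mem (tabloidRep lam n)
        (Tableau.swap_mem_rowStabilizer hr) (polytabloid T')
      rw [tabloidRep_polytabloid_of_mem (Tableau.swap_mem_colStabilizer hc), map_smul,
        Perm.sign_swap hpq] at h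
      rw [eq_zero_of_eq_neg_one_smul (x := symmetrizer _ _ (polytabloid T'))
        (by simpa using h.symm)]
      exact zero_mem _
    · obtain ⟨w, hw, hwT⟩ := Quotient.exact h.symm
      have h1 := tabloidRep_polytabloid_of_mem hσ
      rw [tabloidRep_polytabloid, hwT, ← tabloidRep_polytabloid] at h1
      have h2 : polytabloid T' =
          ((Perm.sign σ : ℤ) : ℝ) • tabloidRep lam n w (polytabloid T) := by
        rw [h1, smul_smul, sign_mul_self_real, one_smul]
      rw [h2, map_smul, symmetrizer_apply_of_mem _ hw]
      exact Submodule.smul_mem _ _ (Submodule.mem_span_singleton_self _)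
  exact hle hx

/-- Only the identity contributes, because the row and column stabilizers meet trivially. -/
theorem polytabloid_apply_tabloid (T : Tableau lam n) : polytabloid T T.tabloid = 1 := by
  classical
  simp only [polytabloid, tabloidRep_tabloidVec, Finset.sum_apply, Pi.smul_apply]
  rw [Finset.sum_eq_single 1]
  · simp [tabloidVec]
  · intro σ _ hσ
    rw [tabloidVec, Pi.single_apply, if_neg, smul_zero]
    intro h
    have hr := Tableau.smul_tabloid_eq_iff.1 h.symm
    exact hσ (Subtype.ext (Equiv.ext fun k => T.eq_of_row_eq_of_col_eq (hr k) (σ.2 k)))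
  · simp

theorem symmetrizer_polytabloid_ne_zero (T : Tableau lam n) :
    symmetrizer (tabloidRep lam n) T.rowStabilizer (polytabloid T) ≠ 0 := by
  intro h
  have h1 := form_symmetrizer (W := T.rowStabilizer) isInvariantInnerForm_tabloidForm
    (polytabloid T) (tabloidVec T.tabloid)
  rw [h, symmetrizer_of_forall_apply_eq (x := tabloidVec T.tabloid), map_smul,
    tabloidForm_tabloidVec, tabloidForm_tabloidVec, polytabloid_apply_tabloid] at h1
  · have hcard : (Nat.card T.rowStabilizer : ℝ) ≠ 0 := Nat.cast_ne_zero.2 Nat.card_pos.ne'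
    exact hcard (by simpa using h1.symm)
  · intro w hw
    rw [tabloidRep_tabloidVec, Tableau.smul_tabloid_eq_iff.2 hw]

/-- Moving both symmetrizers across the form, a zero value would make `u` orthogonal to the
polytabloid v_T; but `|R(T)| B(u, v_T) = B(u, u) > 0`. -/
theorem antisymmetrizer_symmetrizer_ne_zero (T : Tableau lam n) :
    antisymmetrizer (tabloidRep lam n) T.colStabilizer
      (symmetrizer (tabloidRep lam n) T.rowStabilizer (polytabloid T)) ≠ 0 := by
  intro h
  set u := symmetrizer (tabloidRep lam n) T.rowStabilizer (polytabloid T) with hu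
  have hB := isInvariantInnerForm_tabloidForm (lam := lam) (n := n)
  have h1 := form_antisymmetrizer (W := T.colStabilizer) hB u (tabloidVec T.tabloid)
  rw [h, ← polytabloid_eq_antisymmetrizer, map_zero, LinearMap.zero_apply] at h1
  have h2 := form_symmetrizer (W := T.rowStabilizer) hB u (polytabloid T)
  rw [← hu, symmetrizer_of_forall_apply_eq _ fun w hw => apply_symmetrizer_of_mem _ hw _,
    map_smul, LinearMap.smul_apply, ← h1, smul_zero] at h2
  exact (hB.posDef u (symmetrizer_polytabloid_ne_zero T)).ne h2

end Polytabloids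

/-! ### Garnir relations and contents. -/

section Garnir

variable {lam : YoungDiagram} {n : ℕ}

/-- The Garnir relation that exchanges one entry with a column further left. -/
theorem sum_swap_polytabloid (T : Tableau lam n) {k : Fin n} {c : ℕ} (hc : c < T.col k) :
    ∑ i ∈ Finset.univ.filter (fun i => T.col i = c), tabloidRep lam n (swap i k) (polytabloid T) =
      polytabloid T := by
  classical
  have hmem : ∀ σ : T.colStabilizer, (T.row ((σ : Perm (Fin n))⁻¹ k), c) ∈ lam := fun σ => by
    refine lam.up_left_mem le_rfl ?_ (T.cell_mem ((σ : Perm (Fin n))⁻¹ k))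
    rw [inv_mem σ.2 k]
    exact hc.le
  -- In `σ • T`, the entry `e σ` stands in column `c` and in the row of `k`. Swapping it with `k`
  -- fixes the tabloid, so the terms `i = e σ` add up to the polytabloid.
  let e : T.colStabilizer → Fin n := fun σ => (σ : Perm (Fin n)) (T.entry (hmem σ))
  have he_col : ∀ σ, T.col (e σ) = c := fun σ => (σ.2 _).trans (T.col_entry _)
  have he_row : ∀ σ : T.colStabilizer,
      T.row ((σ : Perm (Fin n))⁻¹ (e σ)) = T.row ((σ : Perm (Fin n))⁻¹ k) := fun σ => by
    simp only [e, Perm.inv_def, symm_apply_apply]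
    exact T.row_entry _
  let F : T.colStabilizer → Fin n → TabloidModule lam n := fun σ i =>
    ((Perm.sign (σ : Perm (Fin n)) : ℤ) : ℝ) •
      tabloidVec (((swap i k * σ : Perm (Fin n)) • T).tabloid)
  have hF : ∀ i, tabloidRep lam n (swap i k) (polytabloid T) = ∑ σ, F σ i := fun i => by
    simp only [polytabloid, map_sum, map_smul, tabloidRep_tabloidVec, Tableau.smul_tabloid,
      ← mul_smul, F]
  have hself : ∀ σ : T.colStabilizer, F σ (e σ) = ((Perm.sign (σ : Perm (Fin n)) : ℤ) : ℝ) •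
      tabloidRep lam n σ (tabloidVec T.tabloid) := fun σ => by
    simp only [F, tabloidRep_tabloidVec, Tableau.smul_tabloid]
    congr 2
    refine Tableau.tabloid_eq_iff.2 fun x => ?_
    rw [Tableau.row_smul, Tableau.row_smul, swap_mul_inv_apply, swap_apply_def]
    split_ifs with h1 h2
    · rw [h1, he_row]
    · rw [h2, he_row]
    · rfl
  -- The other terms cancel in pairs under `(σ, i) ↦ (swap i (e σ) * σ, e σ)`, which keeps the
  -- tabloid and flips the sign.
  have hrest : ∑ x ∈ Finset.univ.sigma (fun σ : T.colStabilizer =>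
      (Finset.univ.filter fun i => T.col i = c).erase (e σ)), F x.1 x.2 = 0 := by
    have hswap : ∀ x ∈ Finset.univ.sigma (fun σ : T.colStabilizer =>
        (Finset.univ.filter fun i => T.col i = c).erase (e σ)),
        x.2 ≠ e x.1 ∧ T.col x.2 = c ∧ swap x.2 (e x.1) ∈ T.colStabilizer := fun x hx => by
      simp only [Finset.mem_sigma, Finset.mem_univ, true_and, Finset.mem_erase,
        Finset.mem_filter] at hx
      exact ⟨hx.1, hx.2, Tableau.swap_mem_colStabilizer (hx.2.trans (he_col _).symm)⟩
    have hne : ∀ i, T.col i = c → k ≠ i := fun i hi h => by rw [h, hi] at hc; omega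
    have he_swap : ∀ x (hx : x ∈ Finset.univ.sigma (fun σ : T.colStabilizer =>
        (Finset.univ.filter fun i => T.col i = c).erase (e σ))),
        e (⟨swap x.2 (e x.1), (hswap x hx).2.2⟩ * x.1) = x.2 := fun x hx => by
      have hcol := he_col (⟨swap x.2 (e x.1), (hswap x hx).2.2⟩ * x.1)
      have hrow := he_row (⟨swap x.2 (e x.1), (hswap x hx).2.2⟩ * x.1)
      set i' := e (⟨swap x.2 (e x.1), (hswap x hx).2.2⟩ * x.1) with hi'
      rw [Subgroup.coe_mul, swap_mul_inv_apply, swap_mul_inv_apply,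
        swap_apply_of_ne_of_ne (hne _ (hswap x hx).2.1) (hne _ (he_col _)), ← he_row x.1] at hrow
      have hcol' : T.col (swap x.2 (e x.1) i') = T.col (e x.1) := by
        rw [(hswap x hx).2.2 i', hcol, he_col]
      have := T.eq_of_row_eq_of_col_eq hrow (by
        rw [inv_mem x.1.2, inv_mem x.1.2, hcol'])
      have h2 := (x.1 : Perm (Fin n))⁻¹.injective this
      rw [swap_apply_eq_iff, swap_apply_right] at h2
      exact h2
    refine Finset.sum_involution
      (fun x hx => ⟨⟨swap x.2 (e x.1), (hswap x hx).2.2⟩ * x.1, e x.1⟩) ?_ ?_ ?_ ?_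
    · rintro ⟨σ, i⟩ hx
      obtain ⟨h1, h2, h3⟩ := hswap _ hx
      simp only at h1 h2 h3
      have htab : ((swap (e σ) k * (swap i (e σ) * σ) : Perm (Fin n)) • T).tabloid =
          ((swap i k * σ : Perm (Fin n)) • T).tabloid := by
        refine Tableau.tabloid_eq_iff.2 fun x => ?_
        simp only [Tableau.row_smul, swap_mul_inv_apply]
        have hek := hne _ (he_col σ)
        have hik := hne _ h2
        by_cases hx1 : x = e σ
        · rw [hx1, swap_apply_left, swap_apply_of_ne_of_ne hik hek,
            swap_apply_of_ne_of_ne h1.symm hek.symm, he_row]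
        by_cases hx2 : x = k
        · rw [hx2, swap_apply_right, swap_apply_right, swap_apply_right]
        by_cases hx3 : x = i
        · rw [hx3, swap_apply_of_ne_of_ne h1 hik.symm, swap_apply_left, swap_apply_left, he_row]
        · rw [swap_apply_of_ne_of_ne hx1 hx2, swap_apply_of_ne_of_ne hx3 hx1,
            swap_apply_of_ne_of_ne hx3 hx2]
      simp only [F, Subgroup.coe_mul, htab, Perm.sign_mul, Perm.sign_swap h1]
      simp
    · rintro ⟨σ, i⟩ hx - h
      exact (hswap _ hx).1 (congrArg Sigma.snd h).symm
    · intro x hx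
      simp only [Finset.mem_sigma, Finset.mem_univ, true_and, Finset.mem_erase, Finset.mem_filter]
      exact ⟨by rw [he_swap x hx]; exact (hswap x hx).1.symm, he_col _⟩
    · rintro ⟨σ, i⟩ hx
      have h := he_swap _ hx
      simp only at h
      refine Sigma.ext (Subtype.ext ?_) (heq_of_eq h)
      simp only [Subgroup.coe_mul, h, swap_comm (e σ) i, ← mul_assoc, swap_mul_self, one_mul]
  rw [Finset.sum_sigma] at hrest
  simp only [hF]
  rw [Finset.sum_comm]
  have hsplit : ∀ σ : T.colStabilizer, ∑ i ∈ Finset.univ.filter (fun i => T.col i = c), F σ i =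
      F σ (e σ) + ∑ i ∈ (Finset.univ.filter fun i => T.col i = c).erase (e σ), F σ i := fun σ =>
    (Finset.add_sum_erase _ _ (by simpa using he_col σ)).symm
  simp only [hsplit, Finset.sum_add_distrib, hrest, add_zero, hself, polytabloid]

/-- For the column reading tableau, the Jucys–Murphy elements act on the polytabloid by the
contents of the boxes. -/
theorem sum_lt_swap_polytabloid {T : Tableau lam n}
    (hT : ∀ i k, i < k ↔ T.col i < T.col k ∨ T.col i = T.col k ∧ T.row i < T.row k) (k : Fin n) :
    ∑ i ∈ Finset.univ.filter (· < k), tabloidRep lam n (swap i k) (polytabloid T) =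
      (((T.col k : ℤ) - T.row k : ℤ) : ℝ) • polytabloid T := by
  classical
  have hsplit : Finset.univ.filter (· < k) =
      (Finset.univ.filter fun i => T.col i < T.col k) ∪
        Finset.univ.filter fun i => T.col i = T.col k ∧ T.row i < T.row k := by
    ext i
    simp [hT i k]
  have hdisj : Disjoint (Finset.univ.filter fun i => T.col i < T.col k)
      (Finset.univ.filter fun i => T.col i = T.col k ∧ T.row i < T.row k) := by
    rw [Finset.disjoint_filter]
    intro i _ h1 h2
    omega
  -- Each column left of `k` contributes one polytabloid by the Garnir relation; each entry above
  -- `k` in its own column contributes minus one.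
  have hleft : ∑ i ∈ Finset.univ.filter (fun i => T.col i < T.col k),
      tabloidRep lam n (swap i k) (polytabloid T) = (T.col k : ℝ) • polytabloid T := by
    rw [← Finset.sum_fiberwise_of_maps_to (g := T.col) (t := Finset.range (T.col k))
      (by intro i hi; simpa using hi)]
    have : ∀ c ∈ Finset.range (T.col k),
        ∑ i ∈ (Finset.univ.filter fun i => T.col i < T.col k).filter (fun i => T.col i = c),
          tabloidRep lam n (swap i k) (polytabloid T) = polytabloid T := fun c hc => by
      have hc := Finset.mem_range.1 hc
      rw [Finset.filter_filter]
      conv_rhs => rw [← sum_swap_polytabloid T hc]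
      refine Finset.sum_congr (Finset.filter_congr fun i _ => ?_) fun _ _ => rfl
      exact ⟨fun h => h.2, fun h => ⟨h ▸ hc, h⟩⟩
    rw [Finset.sum_congr rfl this, Finset.sum_const, Finset.card_range, Nat.cast_smul_eq_nsmul]
  have hcard : (Finset.univ.filter fun i => T.col i = T.col k ∧ T.row i < T.row k).card =
      T.row k := by
    have hmem : ∀ r ∈ Finset.range (T.row k), (r, T.col k) ∈ lam := fun r hr =>
      lam.up_left_mem (Finset.mem_range.1 hr).le le_rfl (T.cell_mem k)
    conv_rhs => rw [← Finset.card_range (T.row k)]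
    refine Finset.card_bij' (fun i _ => T.row i) (fun r hr => T.entry (hmem r hr)) ?_ ?_ ?_ ?_
    · intro i hi
      simp only [Finset.mem_filter, Finset.mem_univ, true_and] at hi
      simpa using hi.2
    · intro r hr
      simpa [Tableau.row_entry, Tableau.col_entry] using hr
    · intro i hi
      simp only [Finset.mem_filter, Finset.mem_univ, true_and] at hi
      exact T.eq_of_row_eq_of_col_eq (T.row_entry _) ((T.col_entry _).trans hi.1.symm)
    · intro r hr
      exact T.row_entry _
  have hcol : ∀ i ∈ Finset.univ.filter (fun i => T.col i = T.col k ∧ T.row i < T.row k),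
      tabloidRep lam n (swap i k) (polytabloid T) = (-1 : ℝ) • polytabloid T := fun i hi => by
    simp only [Finset.mem_filter, Finset.mem_univ, true_and] at hi
    rw [tabloidRep_polytabloid_of_mem (Tableau.swap_mem_colStabilizer hi.1),
      Perm.sign_swap fun h => by rw [h] at hi; omega]
    simp
  rw [hsplit, Finset.sum_union hdisj, hleft, Finset.sum_congr rfl hcol, Finset.sum_const, hcard,
    ← Nat.cast_smul_eq_nsmul ℝ]
  push_cast
  module

end Garnir

/-! ### The Specht module: the row invariant vector generates the cones. -/

section Specht

variable {lam : YoungDiagram} {n : ℕ}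

/-- The polytabloid of a tableau as an element of the Specht module. -/
def spechtPolytabloid (T : Tableau lam n) : specht lam n :=
  ⟨polytabloid T, Submodule.subset_span ⟨T, rfl⟩⟩

theorem coe_symmetrizer_spechtRep (W : Subgroup (Perm (Fin n))) (x : specht lam n) :
    (symmetrizer (spechtRep lam n) W x : TabloidModule lam n) =
      symmetrizer (tabloidRep lam n) W x := by
  simp only [symmetrizer, LinearMap.sum_apply, AddSubmonoidClass.coe_finsetSum]
  rfl

theorem coe_antisymmetrizer_spechtRep (W : Subgroup (Perm (Fin n))) (x : specht lam n) :
    (antisymmetrizer (spechtRep lam n) W x : TabloidModule lam n) =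
      antisymmetrizer (tabloidRep lam n) W x := by
  simp only [antisymmetrizer, LinearMap.sum_apply, AddSubmonoidClass.coe_finsetSum]
  rfl

theorem eq_top_of_spechtPolytabloid_mem {U : Submodule ℝ (specht lam n)}
    (hU : ∀ A ∈ onePlus (spechtRep lam n), ∀ x ∈ U, A x ∈ U) {T : Tableau lam n}
    (hT : spechtPolytabloid T ∈ U) : U = ⊤ := by
  have hle : specht lam n ≤ U.map (specht lam n).subtype := by
    refine Submodule.span_le.2 ?_
    rintro _ ⟨T', rfl⟩
    refine ⟨_, apply_mem_of_onePlus_invariant hU (Tableau.transport T T') hT, ?_⟩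
    change tabloidRep lam n (Tableau.transport T T') (polytabloid T) = polytabloid T'
    rw [tabloidRep_polytabloid, Tableau.transport_smul]
  refine eq_top_iff.2 fun x _ => ?_
  obtain ⟨y, hy, hyx⟩ := hle x.2
  rwa [← Subtype.ext hyx]

/-- A vector of the Specht module that is fixed by the row stabilizer of `T`. -/
def rowInvariant (T : Tableau lam n) : specht lam n :=
  symmetrizer (spechtRep lam n) T.rowStabilizer (spechtPolytabloid T)

theorem coe_rowInvariant (T : Tableau lam n) : (rowInvariant T : TabloidModule lam n) =
    symmetrizer (tabloidRep lam n) T.rowStabilizer (polytabloid T) :=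
  coe_symmetrizer_spechtRep _ _

/-- The column antisymmetrizer sends the row invariant vector to a nonzero multiple of a
polytabloid, whose translates span. -/
theorem eq_top_of_rowInvariant_mem {U : Submodule ℝ (specht lam n)}
    (hU : ∀ A ∈ onePlus (spechtRep lam n), ∀ x ∈ U, A x ∈ U) {T : Tableau lam n}
    (hT : rowInvariant T ∈ U) : U = ⊤ := by
  have hmem : antisymmetrizer (spechtRep lam n) T.colStabilizer (rowInvariant T) ∈ U := by
    rw [antisymmetrizer, LinearMap.sum_apply]
    exact Submodule.sum_mem _ fun w _ =>
      Submodule.smul_mem _ _ (apply_mem_of_onePlus_invariant hU _ hT)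
  obtain ⟨c, hc⟩ := Submodule.mem_span_singleton.1 (antisymmetrizer_mem_span T (rowInvariant T))
  have hc' : c • spechtPolytabloid T =
      antisymmetrizer (spechtRep lam n) T.colStabilizer (rowInvariant T) :=
    Subtype.ext (hc.trans (coe_antisymmetrizer_spechtRep _ _).symm)
  have hc0 : c ≠ 0 := by
    rintro rfl
    rw [zero_smul, coe_rowInvariant] at hc
    exact antisymmetrizer_symmetrizer_ne_zero T hc.symm
  refine eq_top_of_spechtPolytabloid_mem hU (T := T) ?_
  rw [← hc'] at hmem
  exact (Submodule.smul_mem_iff _ hc0).1 hmem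

theorem hasWeight_spechtPolytabloid {T : Tableau lam n}
    (hT : ∀ i k, i < k ↔ T.col i < T.col k ∨ T.col i = T.col k ∧ T.row i < T.row k) :
    HasWeight (spechtRep lam n) (fun k => (T.col k : ℤ) - T.row k) (spechtPolytabloid T) := by
  intro k
  refine Subtype.ext ?_
  rw [jucysMurphy, LinearMap.sum_apply, AddSubmonoidClass.coe_finsetSum]
  exact sum_lt_swap_polytabloid hT k

theorem isConeGenerator_rowInvariant (hlam : lam.card = n) {T : Tableau lam n}
    (hT : Monotone T.row) : IsConeGenerator (onePlusReflections lam n) (rowInvariant T) where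
  ne_zero h := symmetrizer_polytabloid_ne_zero T (by rw [← coe_rowInvariant, h]; rfl)
  smul_mem B hB C hC hinv x hx := by
    have hB' := IsSelfAdjointForm.isInvariantInnerForm (ρ := spechtRep lam n) hB
    set u := rowInvariant T with hu
    have hPx : symmetrizer (spechtRep lam n) T.rowStabilizer x ∈ C := by
      rw [symmetrizer, LinearMap.sum_apply]
      exact sum_stabilizer_mem hB' hT (fun σ => Tableau.mem_rowStabilizer) hC hinv hx
    obtain ⟨c, hc⟩ := Submodule.mem_span_singleton.1 (symmetrizer_mem_span T x.2)
    have hc' : c • u = symmetrizer (spechtRep lam n) T.rowStabilizer x :=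
      Subtype.ext (by
        rw [coe_symmetrizer_spechtRep, ← hc, ← coe_rowInvariant]
        rfl)
    have hPu : symmetrizer (spechtRep lam n) T.rowStabilizer u =
        (Nat.card T.rowStabilizer : ℝ) • u :=
      symmetrizer_of_forall_apply_eq _ fun w hw => apply_symmetrizer_of_mem _ hw _
    have hform := form_symmetrizer (W := T.rowStabilizer) hB' u x
    rw [hPu, ← hc', map_smul, map_smul, LinearMap.smul_apply, smul_eq_mul, smul_eq_mul] at hform
    have hcard : (Nat.card T.rowStabilizer : ℝ) ≠ 0 := Nat.cast_ne_zero.2 Nat.card_pos.ne'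
    -- Self-adjointness of the row symmetrizer P, with `P u = |R(T)| u` and `P x = c u`, gives
    -- `|R(T)| B(u, x) = c B(u, u)`.
    have hcoef : B u x • u = (B u u / Nat.card T.rowStabilizer) • (c • u) := by
      rw [smul_smul]
      congr 1
      field_simp
      linarith
    have hnonneg : 0 ≤ B u u := by
      by_cases h0 : u = 0
      · simp [h0]
      · exact (hB.posDef u h0).le
    rw [hcoef, hc']
    exact C.smul_mem (div_nonneg hnonneg (Nat.cast_nonneg _)) hPx
  cyclic U hU hu := eq_top_of_rowInvariant_mem hU hu
  exists_proper := by
    obtain ⟨T', hT'⟩ := Tableau.exists_lt_iff_col_lt hlam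
    exact exists_isProperInvariantCone isInvariantInnerForm_spechtForm
      (hasWeight_spechtPolytabloid hT') fun U hU h => eq_top_of_spechtPolytabloid_mem hU h

end Specht

end InvariantCones

end

open InvariantCones in
theorem mainTheorem3 (n : ℕ) (lam : YoungDiagram) (hlam : lam.card = n) :
    ∃ Cmax Cmin : PointedCone ℝ (specht lam n),
      (∀ C : PointedCone ℝ (specht lam n),
        Maximal (IsProperInvariantCone (onePlusReflections lam n)) C ↔ C = Cmax ∨ C = -Cmax) ∧
      (∀ C : PointedCone ℝ (specht lam n),
        Minimal (IsProperInvariantCone (onePlusReflections lam n)) C ↔ C = Cmin ∨ C = -Cmin) ∧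
      (∀ C : PointedCone ℝ (specht lam n),
        IsProperInvariantCone (onePlusReflections lam n) C →
          (Cmin ≤ C ∧ C ≤ Cmax) ∨ (Cmin ≤ -C ∧ -C ≤ Cmax)) ∧
      (∀ B : LinearMap.BilinForm ℝ (specht lam n),
        IsInvariantInnerForm (spechtRep lam n) B → dualCone B Cmax = Cmin) := by
  obtain ⟨T, hT⟩ := Tableau.exists_row_monotone hlam
  have hu := isConeGenerator_rowInvariant hlam hT
  have hB : IsSelfAdjointForm (onePlusReflections lam n) (spechtForm lam n) :=
    isInvariantInnerForm_spechtForm.isSelfAdjointForm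
  refine ⟨dualCone (spechtForm lam n) (leastCone (onePlusReflections lam n) (rowInvariant T)),
    leastCone (onePlusReflections lam n) (rowInvariant T), fun C => hu.maximal_iff hB,
    fun C => hu.minimal_iff hB, fun C hC => hu.leastCone_le_and_le hB hC, fun B hB' => ?_⟩
  have hB'' : IsSelfAdjointForm (onePlusReflections lam n) B := hB'.isSelfAdjointForm
  -- The maximal cone was built with `spechtForm`; it is the same for `B`, so the bipolar theorem
  -- applies to `B` alone.
  rw [hu.dualCone_leastCone_congr hB hB'']
  exact dualCone_dualCone hB'' (isClosed_leastCone _ _)
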